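/- A planar map is a connected finite graph (loops and multiple edges allowed) embedded in the sphere, considered up to orientation-preserving homeomorphisms of the sphere. A unicycle is a planar map with exactly two faces, one of which is called internal and the other external; its underlying graph contains a unique cycle. It is well-labelled if its vertices carry integer labels such that the labels of any two adjacent vertices differ by at most $1$. Let $\mathbb U_n$ be the set of well-labelled unicycles with $n$ edges that are rooted, i.e. that have a distinguished oriented edge, the origin of which has label $0$. Let $\mathbb U_n^\bullet$ be the set of well-labelled unicycles with $n$ edges and, instead of a root, a distinguished edge on their unique cycle; this edge is oriented so that the external face lies on its right, and the origin of this oriented edge has label $0$. In both sets, unicycles are identified when an orientation-preserving homeomorphism of the sphere maps one to the other and respects the internal and external faces, the labels and the distinguished edge. **Theorem 2.8.** As $n\to\infty$, $$\#\mathbb U_n\sim\frac{\sqrt3\,\Gamma(1/4)\,12^n}{2\pi\,n^{1/4}}\qquad\text{and}\qquad \#\mathbb U_n^\bullet\sim\frac{\sqrt3\,\Gamma(3/4)\,12^n}{4\pi\,n^{3/4}}.$$ -/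

import Mathlib

/-- A connected map on an oriented surface with set of oriented edges (darts) `D`, encoded as a
rotation system: `rev` reverses an oriented edge, and `rot d` is the oriented edge that follows `d`
in clockwise order around the origin of `d`. Loops and multiple edges are allowed. -/
structure CombMap (D : Type) where
  rev : Equiv.Perm D
  rot : Equiv.Perm D
  rev_rev : ∀ d, rev (rev d) = d
  rev_ne : ∀ d, rev d ≠ d
  connected : ∀ d d' : D, ∃ g ∈ Subgroup.closure ({rev, rot} : Set (Equiv.Perm D)), g d = d'

namespace CombMap

variable {D : Type}

/-- Vertices are the cycles of `rot` (each cycle is the set of darts leaving the vertex). -/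
def Vertex (m : CombMap D) : Type := Quotient (Equiv.Perm.SameCycle.setoid m.rot)

/-- Unoriented edges are the pairs `{d, rev d}`. -/
def Edge (m : CombMap D) : Type := Quotient (Equiv.Perm.SameCycle.setoid m.rev)

/-- The dart that follows `d` along the boundary of the face on the left of `d`: traverse `d`,
then take the dart that comes clockwise after the reversal of `d`. -/
def faceNext (m : CombMap D) : Equiv.Perm D := m.rot * m.rev

/-- Faces are the cycles of `faceNext` (each cycle is the set of darts with the face on
their left). -/
def Face (m : CombMap D) : Type := Quotient (Equiv.Perm.SameCycle.setoid m.faceNext)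

def origin (m : CombMap D) (d : D) : m.Vertex := Quotient.mk _ d

def target (m : CombMap D) (d : D) : m.Vertex := m.origin (m.rev d)

def edge (m : CombMap D) (d : D) : m.Edge := Quotient.mk _ d

def leftFace (m : CombMap D) (d : D) : m.Face := Quotient.mk _ d

def rightFace (m : CombMap D) (d : D) : m.Face := m.leftFace (m.rev d)

/-- Two vertices are adjacent if some edge joins them. -/
def Adj (m : CombMap D) (x y : m.Vertex) : Prop := ∃ d, m.origin d = x ∧ m.target d = y

/-- The (connected) map is drawn on the sphere: Euler's formula `V - E + F = 2`. -/
def IsPlanar (m : CombMap D) : Prop :=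
  Nat.card m.Vertex + Nat.card m.Face = Nat.card m.Edge + 2

/-- `c 0, …, c k` (with indices modulo `k + 1`) is a cycle of length `k + 1` of the underlying
multigraph: consecutive oriented edges, with distinct vertices and distinct edges. -/
def IsCycle (m : CombMap D) {k : ℕ} (c : Fin (k + 1) → D) : Prop :=
  (∀ i, m.target (c i) = m.origin (c (i + 1))) ∧
    Function.Injective (fun i => m.origin (c i)) ∧ Function.Injective (fun i => m.edge (c i))

/-- The edge underlying the dart `d` lies on a cycle of the underlying multigraph. -/
def OnCycle (m : CombMap D) (d : D) : Prop :=
  ∃ (k : ℕ) (c : Fin (k + 1) → D), m.IsCycle c ∧ ∃ i, m.edge (c i) = m.edge d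

end CombMap

/-- A unicycle: a planar map with exactly two faces, one of which is called internal, and the
other one external. -/
structure Unicycle (D : Type) extends CombMap D where
  planar : toCombMap.IsPlanar
  internal : toCombMap.Face
  external : toCombMap.Face
  internal_ne_external : internal ≠ external
  eq_or_eq : ∀ f : toCombMap.Face, f = internal ∨ f = external

/-- A well-labelled unicycle with a distinguished oriented edge `root`: the integer labels of
adjacent vertices differ by at most one, and the origin of the distinguished oriented edge has
label `0`. -/
structure RootedUnicycle (D : Type) extends Unicycle D where
  label : toCombMap.Vertex → ℤ
  wellLabelled : ∀ x y, toCombMap.Adj x y → |label x - label y| ≤ 1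
  root : D
  label_root : label (toCombMap.origin root) = 0

namespace RootedUnicycle

variable {D : Type}

/-- Equality of rooted well-labelled unicycles as maps, that is up to renaming of the darts (the
combinatorial form of an orientation-preserving homeomorphism of the sphere which respects the two
distinguished faces, the labels and the root). -/
def Iso (u v : RootedUnicycle D) : Prop :=
  ∃ e : D ≃ D,
    (∀ d, e (u.rev d) = v.rev (e d)) ∧
    (∀ d, e (u.rot d) = v.rot (e d)) ∧
    (∀ d, u.leftFace d = u.internal ↔ v.leftFace (e d) = v.internal) ∧
    (∀ d, u.leftFace d = u.external ↔ v.leftFace (e d) = v.external) ∧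
    (∀ d, u.label (u.origin d) = v.label (v.origin (e d))) ∧
    e u.root = v.root

theorem Iso.refl (u : RootedUnicycle D) : Iso u u :=
  ⟨Equiv.refl D, by simp⟩

theorem Iso.symm {u v : RootedUnicycle D} (h : Iso u v) : Iso v u := by
  obtain ⟨e, h1, h2, h3, h4, h5, h6⟩ := h
  refine ⟨e.symm, fun d => ?_, fun d => ?_, fun d => ?_, fun d => ?_, fun d => ?_, ?_⟩
  · rw [Equiv.symm_apply_eq, h1, Equiv.apply_symm_apply]
  · rw [Equiv.symm_apply_eq, h2, Equiv.apply_symm_apply]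
  · rw [h3, Equiv.apply_symm_apply]
  · rw [h4, Equiv.apply_symm_apply]
  · rw [h5, Equiv.apply_symm_apply]
  · rw [Equiv.symm_apply_eq, h6]

theorem Iso.trans {u v w : RootedUnicycle D} (h : Iso u v) (h' : Iso v w) : Iso u w := by
  obtain ⟨e, h1, h2, h3, h4, h5, h6⟩ := h
  obtain ⟨f, k1, k2, k3, k4, k5, k6⟩ := h'
  refine ⟨e.trans f, fun d => ?_, fun d => ?_, fun d => ?_, fun d => ?_, fun d => ?_, ?_⟩
  · simp [h1, k1]
  · simp [h2, k2]
  · simp [h3, k3]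
  · simp [h4, k4]
  · simp [h5, k5]
  · simp [h6, k6]

instance isoSetoid (D : Type) : Setoid (RootedUnicycle D) where
  r := Iso
  iseqv := ⟨Iso.refl, Iso.symm, Iso.trans⟩

/-- The distinguished edge lies on the cycle of the unicycle, and its orientation is the natural
one, which has the external face on its right. -/
def RootOnCycle (u : RootedUnicycle D) : Prop :=
  u.OnCycle u.root ∧ u.rightFace u.root = u.external

end RootedUnicycle

/-- The set of rooted well-labelled unicycles with `n` edges (that is `2 n` oriented edges). -/
def WellLabelledUnicycles (n : ℕ) : Type :=
  Quotient (RootedUnicycle.isoSetoid (Fin (2 * n)))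

/-- The set of well-labelled unicycles with `n` edges, and with a distinguished edge on their
cycle instead of the root edge. The distinguished edge is given through its natural orientation,
and the labels are normalized to vanish at the origin of this oriented edge. -/
def CyclePointedUnicycles (n : ℕ) : Type :=
  Quotient ((RootedUnicycle.isoSetoid (Fin (2 * n))).comap
    (Subtype.val : {u : RootedUnicycle (Fin (2 * n)) // u.RootOnCycle} → _))

/-! Both cardinals have exact formulas. Write T_k for `centralTrinomial k`. Then #U_n = 2 Σ_{1≤k≤n}
T_k 3^(n-k) C(2n, n+k) (`card_wellLabelledUnicycles`) and n · #U_n^• = Σ_{1≤k≤n} k T_k 3^(n-k) C(2n,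
n+k) (`card_cyclePointedUnicycles`), where k is the length of the cycle.

Labels: the increments along the edges are free off the cycle and sum to zero around it, which gives
3^(n-k) T_k labellings (`Unicycle.card_labelling`). That there is no other constraint is planarity:
gradients have dimension V - 1, antisymmetric functions with zero circulation around a face have
dimension E - 1, and V = E for a planar map with two faces (`CombMap.isPlanar_iff_of_two_faces`).

Maps: everything is counted with darts named by `Fin (2 * n)`. A map with a distinguished dart has
no nontrivial automorphism, so each class has (2n)! representatives. Given a distinguished cycle
edge, number the darts along the external face, from the reversal of that edge, and then along the
internal face, ending with that edge. Deleting the edge leaves a plane tree, so `rev` is a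
noncrossing matching that joins the first dart to the last one, and the cycle edges are the arcs
above the position t where the second face begins. Such a matching is a positive excursion with
height k at time t. Cutting it at t gives two first-passage numbers, and their sum over t is the
first-passage number to 2k, that is (k/n) C(2n, n+k) by the ballot theorem (`card_cyclePointed`,
`mul_firstPassage`). This counts each unicycle k times, whereas it has 2n roots, whence the factor
2n/k between the summands of #U_n^• and #U_n.

Asymptotics: Fourier inversion gives T_k ~ 3^k √3 / (2√(πk)). The ratio C(2n, n+k) / C(2n, n) is
close to exp(-k²/n). At the scale k = s√n the sums become ∫ s^a exp(-s²) ds = Γ((a+1)/2)/2, with a =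
-1/2 and a = 1/2 respectively (`tendsto_sum_mul_centralRatio`). -/

open Filter Topology MeasureTheory

/-! ### Asymptotics of the central trinomial coefficients -/

/-- The number of walks with `k` steps in `{-1, 0, 1}` which return to their starting point. -/
noncomputable def centralTrinomial (k : ℕ) : ℕ :=
  (Finset.univ.filter fun g : Fin k → Finset.Icc (-1 : ℤ) 1 => ∑ i, (g i : ℤ) = 0).card

/-- Real part of the characteristic function of the walk: the sum of exp(ixθ) over one step is 1 + 2
cos θ, and independent steps multiply. -/
lemma sum_cos_steps (k : ℕ) (θ : ℝ) :
    ∑ g : Fin k → Finset.Icc (-1 : ℤ) 1, Real.cos ((∑ i, (g i : ℤ) : ℤ) * θ) =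
      (1 + 2 * Real.cos θ) ^ k := by
  have h1 : ∑ x : Finset.Icc (-1 : ℤ) 1, Complex.exp ((x : ℤ) * θ * Complex.I) =
      ((1 + 2 * Real.cos θ : ℝ) : ℂ) := by
    rw [Finset.sum_coe_sort (Finset.Icc (-1 : ℤ) 1)
      (fun x : ℤ => Complex.exp ((x : ℤ) * θ * Complex.I))]
    have : Finset.Icc (-1 : ℤ) 1 = {-1, 0, 1} := by decide
    rw [this]
    have h2 := Complex.two_cos (θ : ℂ)
    push_cast
    rw [h2]
    simp
    ring
  have h3 := Finset.prod_univ_sum (fun _ : Fin k => (Finset.univ : Finset (Finset.Icc (-1 : ℤ) 1)))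
    (fun _ x => Complex.exp ((x : ℤ) * θ * Complex.I))
  simp only [h1, Finset.prod_const, Finset.card_univ, Fintype.card_fin, Fintype.piFinset_univ,
    ← Complex.exp_sum] at h3
  have h4 := congrArg Complex.re h3
  rw [← Complex.ofReal_pow, Complex.ofReal_re, Complex.re_sum] at h4
  rw [h4]
  refine Finset.sum_congr rfl fun g _ => ?_
  rw [← Complex.exp_ofReal_mul_I_re]
  congr 2
  push_cast
  simp only [Finset.sum_mul]

lemma integral_cos_int_mul (m : ℤ) :
    ∫ θ in (-Real.pi)..Real.pi, Real.cos (m * θ) = if m = 0 then 2 * Real.pi else 0 := by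
  split_ifs with h
  · subst h; simp; ring
  · have : (m : ℝ) ≠ 0 := by exact_mod_cast h
    rw [intervalIntegral.integral_comp_mul_left (fun x => Real.cos x) this]
    simp [Real.sin_int_mul_pi]

lemma integral_one_add_two_cos_pow (k : ℕ) :
    ∫ θ in (-Real.pi)..Real.pi, (1 + 2 * Real.cos θ) ^ k = 2 * Real.pi * centralTrinomial k := by
  simp_rw [← sum_cos_steps]
  rw [intervalIntegral.integral_finsetSum
    (fun g _ => (by fun_prop : Continuous _).intervalIntegrable _ _)]
  simp_rw [integral_cos_int_mul]
  rw [← Finset.sum_filter, Finset.sum_const, nsmul_eq_mul, centralTrinomial]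
  ring

/-- Gaussian domination on the whole period. The rate 1/π² keeps the exponent at least -1, so that
the bound also covers the minimum -1/3, because 1/3 ≤ 1/e; the upper side comes from cos θ ≤ 1 -
2θ²/π². -/
lemma abs_one_add_two_cos_div_three_le {θ : ℝ} (h : |θ| ≤ Real.pi) :
    |(1 + 2 * Real.cos θ) / 3| ≤ Real.exp (-(θ ^ 2 / Real.pi ^ 2)) := by
  have hp := Real.pi_pos
  have hθ : θ ^ 2 / Real.pi ^ 2 ≤ 1 := by
    rw [div_le_one (by positivity)]
    exact sq_le_sq' (by linarith [abs_le.1 h]) (abs_le.1 h).2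
  have h0 : 0 ≤ θ ^ 2 / Real.pi ^ 2 := by positivity
  rw [abs_le]
  constructor
  · have h1 : Real.exp (-1) ≤ Real.exp (-(θ ^ 2 / Real.pi ^ 2)) := by
      gcongr
    have h2 : 1 / 3 ≤ Real.exp (-1) := by
      rw [Real.exp_neg, ← one_div]
      exact one_div_le_one_div_of_le (Real.exp_pos _) (by linarith [Real.exp_one_lt_d9])
    linarith [Real.neg_one_le_cos θ]
  · have h1 := Real.cos_le_one_sub_mul_cos_sq h
    have h2 := Real.add_one_le_exp (-(θ ^ 2 / Real.pi ^ 2))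
    have : 2 / Real.pi ^ 2 * θ ^ 2 = 2 * (θ ^ 2 / Real.pi ^ 2) := by ring
    linarith

lemma tendsto_mul_one_sub_cos_div_sqrt (u : ℝ) :
    Tendsto (fun k : ℕ => (k : ℝ) * (Real.cos (u / √k) - 1)) atTop (𝓝 (-(u ^ 2 / 2))) := by
  have hs : Tendsto (fun k : ℕ => u / √(k : ℝ)) atTop (𝓝 0) :=
    tendsto_const_nhds.div_atTop (Real.tendsto_sqrt_atTop.comp tendsto_natCast_atTop_atTop)
  have h1 : ∀ᶠ k : ℕ in atTop, |u / √(k : ℝ)| ≤ 1 :=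
    (hs.abs.eventually (ge_mem_nhds (by simp : |(0 : ℝ)| < 1)))
  rw [← sub_zero (-(u ^ 2 / 2)), tendsto_iff_norm_sub_tendsto_zero]
  refine squeeze_zero_norm' (a := fun k : ℕ => u ^ 4 * (5 / 96) * (1 / (k : ℝ))) ?_ ?_
  · filter_upwards [h1, eventually_gt_atTop 0] with k hk hk0
    have hk0' : (0 : ℝ) < k := by exact_mod_cast hk0
    have hb := Real.cos_bound hk
    have hsq : √(k : ℝ) ^ 2 = k := Real.sq_sqrt hk0'.le
    have e1 : (k : ℝ) * (Real.cos (u / √k) - 1) - (-(u ^ 2 / 2) - 0) =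
        k * (Real.cos (u / √k) - (1 - (u / √k) ^ 2 / 2)) := by
      rw [div_pow, hsq]; field_simp; ring
    rw [norm_norm, e1, norm_mul, Real.norm_eq_abs, Real.norm_eq_abs, abs_of_pos hk0']
    calc (k : ℝ) * |Real.cos (u / √k) - (1 - (u / √k) ^ 2 / 2)|
        ≤ k * (|u / √k| ^ 4 * (5 / 96)) := by gcongr
      _ = u ^ 4 * (5 / 96) * (1 / k) := by
        rw [Even.pow_abs (by decide), div_pow, show √(k : ℝ) ^ 4 = (√(k : ℝ) ^ 2) ^ 2 by ring, hsq]
        field_simp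
  · simpa using (tendsto_one_div_atTop_nhds_zero_nat (𝕜 := ℝ)).const_mul (u ^ 4 * (5 / 96))

/-- The number of returning three-step walks of length `k` is equivalent to
`3 ^ k * √3 / (2 √(π k))`. -/
lemma tendsto_sqrt_mul_centralTrinomial :
    Tendsto (fun k : ℕ => √k * (centralTrinomial k / 3 ^ k : ℝ)) atTop
      (𝓝 (√3 / (2 * √Real.pi))) := by
  -- Extended by zero outside one period, the integrand can be rescaled by θ = u/√k and integrated
  -- over the whole line, where dominated convergence applies.
  set f : ℕ → ℝ → ℝ := fun k θ =>
    (Set.Ioc (-Real.pi) Real.pi).indicator (fun θ => ((1 + 2 * Real.cos θ) / 3) ^ k) θ with hf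
  have hp := Real.pi_pos
  have key : Tendsto (fun k : ℕ => ∫ u : ℝ, f k (u / √k)) atTop
      (𝓝 (∫ u : ℝ, Real.exp (-(1 / 3) * u ^ 2))) := by
    refine tendsto_integral_filter_of_dominated_convergence
      (fun u => Real.exp (-(1 / Real.pi ^ 2) * u ^ 2)) ?_ ?_ ?_ ?_
    · refine Eventually.of_forall fun k => Measurable.aestronglyMeasurable ?_
      have : Measurable (f k) := Measurable.indicator (by fun_prop) measurableSet_Ioc
      exact this.comp (by fun_prop)
    · filter_upwards [eventually_gt_atTop 0] with k hk
      refine ae_of_all _ fun u => ?_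
      have hk0' : (0 : ℝ) < k := by exact_mod_cast hk
      have hsq : √(k : ℝ) ^ 2 = k := Real.sq_sqrt hk0'.le
      simp only [hf, Set.indicator_apply]
      split_ifs with h
      · have hle : |u / √k| ≤ Real.pi := abs_le.2 ⟨h.1.le, h.2⟩
        rw [norm_pow, Real.norm_eq_abs]
        refine (pow_le_pow_left₀ (abs_nonneg _) (abs_one_add_two_cos_div_three_le hle) k).trans ?_
        rw [← Real.exp_nat_mul, div_pow, hsq]
        apply le_of_eq
        congr 1
        field_simp
      · simp [Real.exp_nonneg]
    · exact integrable_exp_neg_mul_sq (by positivity)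
    · refine ae_of_all _ fun u => ?_
      have h0 : Tendsto (fun k : ℕ => u / √(k : ℝ)) atTop (𝓝 0) :=
        tendsto_const_nhds.div_atTop (Real.tendsto_sqrt_atTop.comp tendsto_natCast_atTop_atTop)
      have h1 : ∀ᶠ k : ℕ in atTop, u / √(k : ℝ) ∈ Set.Ioc (-Real.pi) Real.pi :=
        h0.eventually (Ioc_mem_nhds (by linarith) hp)
      have h2 := Real.tendsto_one_add_pow_exp_of_tendsto
        (g := fun k : ℕ => (2 / 3) * (Real.cos (u / √k) - 1)) (t := (2 / 3) * (-(u ^ 2 / 2))) ?_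
      · rw [show (-(1 / 3) * u ^ 2 : ℝ) = (2 / 3) * (-(u ^ 2 / 2)) by ring]
        refine h2.congr' ?_
        filter_upwards [h1] with k hk
        simp only [hf]
        rw [Set.indicator_of_mem hk]
        congr 1
        ring
      · refine ((tendsto_mul_one_sub_cos_div_sqrt u).const_mul (2 / 3)).congr fun k => ?_
        ring
  have h1 : ∀ k : ℕ, ∫ u : ℝ, f k (u / √k) = √k * (2 * Real.pi * (centralTrinomial k / 3 ^ k)) := by
    intro k
    rw [Measure.integral_comp_div (f k) (√(k : ℝ)), abs_of_nonneg (Real.sqrt_nonneg _), smul_eq_mul]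
    congr 1
    rw [integral_indicator measurableSet_Ioc,
      ← intervalIntegral.integral_of_le (by linarith)]
    simp_rw [div_pow]
    rw [intervalIntegral.integral_div, integral_one_add_two_cos_pow]
    ring
  simp_rw [h1] at key
  rw [integral_gaussian] at key
  have := key.const_mul (1 / (2 * Real.pi))
  refine (this.congr fun k => ?_).trans_eq ?_
  · field_simp
  · congr 1
    rw [show Real.pi / (1 / 3) = 3 * Real.pi by ring, Real.sqrt_mul (by norm_num)]
    have h : √Real.pi * √Real.pi = Real.pi := Real.mul_self_sqrt hp.le
    have h' : √Real.pi ≠ 0 := by positivity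
    field_simp
    linear_combination h

/-! ### Binomial coefficients at distance of order √n from the centre -/

/-- The ratio of the binomial coefficient `2n choose n + k` to the central one. -/
noncomputable def centralRatio (n k : ℕ) : ℝ := (2 * n).choose (n + k) / (2 * n).choose n

lemma centralRatio_zero (n : ℕ) : centralRatio n 0 = 1 := by
  have : ((2 * n).choose n : ℝ) ≠ 0 := by
    exact_mod_cast (Nat.choose_pos (by omega : n ≤ 2 * n)).ne'
  simp [centralRatio, this]

lemma centralRatio_succ_mul {n k : ℕ} (h : k ≤ n) :
    centralRatio n (k + 1) * (n + k + 1) = centralRatio n k * (n - k) := by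
  have h1 := Nat.choose_succ_right_eq (2 * n) (n + k)
  have h2 : 2 * n - (n + k) = n - k := by omega
  rw [h2] at h1
  have h3 : ((2 * n).choose (n + (k + 1)) : ℝ) * (n + k + 1) = (2 * n).choose (n + k) * (n - k) := by
    rw [← Nat.cast_sub h]
    exact_mod_cast h1
  rw [centralRatio, centralRatio, div_mul_eq_mul_div, h3, mul_div_right_comm]

lemma centralRatio_nonneg (n k : ℕ) : 0 ≤ centralRatio n k := by
  unfold centralRatio; positivity

lemma centralRatio_eq_zero {n k : ℕ} (h : n < k) : centralRatio n k = 0 := by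
  rw [centralRatio, Nat.choose_eq_zero_of_lt (by omega)]; simp

/-- The quotient of consecutive ratios is 1 - (2k+1)/(n+k+1), at most exp(-(2k+1)/(n+m)), and the
odd numbers add up to k². The bound m keeps the denominator fixed in the induction; it is later
taken to be n, for domination, or k, for the limit. -/
lemma centralRatio_le_of_le {n m k : ℕ} (hk : k ≤ m) (hm : m ≤ n) :
    centralRatio n k ≤ Real.exp (-(k ^ 2 / (n + m))) := by
  induction k with
  | zero => simp [centralRatio_zero]
  | succ k ih =>
    have ih := ih (by omega)
    have h := centralRatio_succ_mul (n := n) (k := k) (by omega)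
    have hpos : (0 : ℝ) < n + k + 1 := by positivity
    have hkm : (k : ℝ) + 1 ≤ m := by exact_mod_cast hk
    have h1 : centralRatio n (k + 1) = centralRatio n k * (1 - (2 * k + 1) / (n + k + 1)) := by
      rw [eq_comm, ← mul_left_inj' hpos.ne', h]; field_simp; ring
    have h2 : 1 - (2 * k + 1) / (n + k + 1 : ℝ) ≤ Real.exp (-((2 * k + 1) / (n + m))) := by
      have h3 := Real.add_one_le_exp (-((2 * k + 1) / (n + m : ℝ)))
      have h4 : (2 * k + 1) / (n + m : ℝ) ≤ (2 * k + 1) / (n + k + 1 : ℝ) := by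
        exact div_le_div_of_nonneg_left (by positivity) hpos (by linarith)
      linarith
    calc centralRatio n (k + 1) = centralRatio n k * (1 - (2 * k + 1) / (n + k + 1)) := h1
      _ ≤ centralRatio n k * Real.exp (-((2 * k + 1) / (n + m))) := by
        gcongr; exact centralRatio_nonneg n k
      _ ≤ Real.exp (-(k ^ 2 / (n + m))) * Real.exp (-((2 * k + 1) / (n + m))) := by gcongr
      _ = _ := by
        rw [← Real.exp_add]; congr 1; push_cast; ring

/-- The same telescoping, applied to the inverse quotients 1 + (2k+1)/(n-k). -/
lemma le_centralRatio_of_le {n m k : ℕ} (hk : k ≤ m) (hm : m < n) :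
    Real.exp (-(k ^ 2 / (n - m))) ≤ centralRatio n k := by
  induction k with
  | zero => simp [centralRatio_zero]
  | succ k ih =>
    have ih := ih (by omega)
    have h := centralRatio_succ_mul (n := n) (k := k) (by omega)
    have hpos : (0 : ℝ) < n + k + 1 := by positivity
    have hkm : (k : ℝ) + 1 ≤ m := by exact_mod_cast hk
    have hmn : (m : ℝ) + 1 ≤ n := by exact_mod_cast hm
    have hnk : (0 : ℝ) < n - k := by linarith
    have hnm : (0 : ℝ) < n - m := by linarith
    have h1 : centralRatio n k = centralRatio n (k + 1) * (1 + (2 * k + 1) / (n - k)) := by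
      rw [← mul_left_inj' hnk.ne', ← h]; field_simp; ring
    have h2 : 1 + (2 * k + 1) / (n - k : ℝ) ≤ Real.exp ((2 * k + 1) / (n - m)) := by
      have h3 := Real.add_one_le_exp ((2 * k + 1) / (n - m : ℝ))
      have h4 : (2 * k + 1) / (n - k : ℝ) ≤ (2 * k + 1) / (n - m : ℝ) := by
        gcongr
        linarith
      linarith
    have h5 : centralRatio n k ≤ centralRatio n (k + 1) * Real.exp ((2 * k + 1) / (n - m)) := by
      rw [h1]; gcongr; exact centralRatio_nonneg n _
    calc Real.exp (-((k + 1 : ℕ) ^ 2 / (n - m)))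
        = Real.exp (-(k ^ 2 / (n - m))) * Real.exp (-((2 * k + 1) / (n - m))) := by
          rw [← Real.exp_add]; congr 1; push_cast; ring
      _ ≤ centralRatio n (k + 1) * Real.exp ((2 * k + 1) / (n - m)) *
          Real.exp (-((2 * k + 1) / (n - m))) := by gcongr; exact ih.trans h5
      _ = _ := by rw [mul_assoc, ← Real.exp_add]; simp

lemma centralRatio_le (n k : ℕ) : centralRatio n k ≤ Real.exp (-(k ^ 2 / (2 * n))) := by
  by_cases h : k ≤ n
  · refine (centralRatio_le_of_le h le_rfl).trans_eq ?_
    rw [two_mul]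
  · rw [centralRatio_eq_zero (by omega)]
    positivity

lemma tendsto_ceil_mul_sqrt_div (s : ℝ) (hs : 0 < s) :
    Tendsto (fun n : ℕ => (⌈√n * s⌉₊ : ℝ) / √n) atTop (𝓝 s) := by
  have hsq : Tendsto (fun n : ℕ => √(n : ℝ)) atTop atTop :=
    Real.tendsto_sqrt_atTop.comp tendsto_natCast_atTop_atTop
  have h1 : Tendsto (fun n : ℕ => s + 1 / √(n : ℝ)) atTop (𝓝 s) := by
    simpa using (tendsto_const_nhds (x := s)).add
      ((tendsto_const_nhds (x := (1 : ℝ))).div_atTop hsq)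
  refine tendsto_of_tendsto_of_tendsto_of_le_of_le' tendsto_const_nhds h1 ?_ ?_
  · filter_upwards [hsq.eventually_gt_atTop 0] with n hn
    rw [le_div_iff₀ hn, mul_comm]
    exact Nat.le_ceil _
  · filter_upwards [hsq.eventually_gt_atTop 0] with n hn
    rw [div_le_iff₀ hn]
    have := Nat.ceil_lt_add_one (a := √(n : ℝ) * s) (by positivity)
    refine this.le.trans (le_of_eq ?_)
    field_simp

lemma tendsto_centralRatio (s : ℝ) (hs : 0 < s) :
    Tendsto (fun n : ℕ => centralRatio n ⌈√n * s⌉₊) atTop (𝓝 (Real.exp (-s ^ 2))) := by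
  have hsq : Tendsto (fun n : ℕ => √(n : ℝ)) atTop atTop :=
    Real.tendsto_sqrt_atTop.comp tendsto_natCast_atTop_atTop
  have h1 := tendsto_ceil_mul_sqrt_div s hs
  have h2 : Tendsto (fun n : ℕ => (⌈√n * s⌉₊ : ℝ) / n) atTop (𝓝 0) := by
    refine (h1.div_atTop hsq).congr fun n => ?_
    rw [div_div, Real.mul_self_sqrt (Nat.cast_nonneg n)]
  have h3 : ∀ᶠ n : ℕ in atTop, ⌈√(n : ℝ) * s⌉₊ < n := by
    filter_upwards [h2.eventually (gt_mem_nhds one_pos), eventually_gt_atTop 0] with n hn hn0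
    rw [div_lt_one (by exact_mod_cast hn0)] at hn
    exact_mod_cast hn
  have hlow : Tendsto (fun n : ℕ => Real.exp (-((⌈√n * s⌉₊ : ℝ) ^ 2 / (n - ⌈√n * s⌉₊)))) atTop
      (𝓝 (Real.exp (-s ^ 2))) := by
    refine (Real.continuous_exp.tendsto _).comp (Tendsto.neg ?_)
    have := (h1.pow 2).div ((tendsto_const_nhds (x := (1 : ℝ))).sub h2) (by norm_num)
    rw [sub_zero, div_one] at this
    refine this.congr' ?_
    filter_upwards [h3, eventually_gt_atTop 0] with n hn hn0
    have hn0' : (0 : ℝ) < n := by exact_mod_cast hn0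
    have hn' : (⌈√n * s⌉₊ : ℝ) < n := by exact_mod_cast hn
    simp only [Pi.div_apply]
    rw [div_pow, Real.sq_sqrt hn0'.le, one_sub_div hn0'.ne', div_div_div_cancel_right₀ hn0'.ne']
  have hhigh : Tendsto (fun n : ℕ => Real.exp (-((⌈√n * s⌉₊ : ℝ) ^ 2 / (n + ⌈√n * s⌉₊)))) atTop
      (𝓝 (Real.exp (-s ^ 2))) := by
    refine (Real.continuous_exp.tendsto _).comp (Tendsto.neg ?_)
    have := (h1.pow 2).div ((tendsto_const_nhds (x := (1 : ℝ))).add h2) (by norm_num)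
    rw [add_zero, div_one] at this
    refine this.congr' ?_
    filter_upwards [h3, eventually_gt_atTop 0] with n hn hn0
    have hn0' : (0 : ℝ) < n := by exact_mod_cast hn0
    simp only [Pi.div_apply]
    rw [div_pow, Real.sq_sqrt hn0'.le, one_add_div hn0'.ne', div_div_div_cancel_right₀ hn0'.ne']
  refine tendsto_of_tendsto_of_tendsto_of_le_of_le' hlow hhigh ?_ ?_
  · filter_upwards [h3] with n hn using le_centralRatio_of_le le_rfl hn
  · filter_upwards [h3] with n hn using centralRatio_le_of_le le_rfl hn.le

/-- A sum is the integral of a step function. -/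
lemma integral_comp_ceil (h : ℕ → ℝ) (n : ℕ) :
    ∫ x in Set.Ioc (0 : ℝ) n, h ⌈x⌉₊ = ∑ k ∈ Finset.Icc 1 n, h k := by
  have h1 : ∀ k : ℕ, Set.EqOn (fun x : ℝ => h ⌈x⌉₊) (fun _ => h (k + 1))
      (Set.Ioc (k : ℝ) ((k + 1 : ℕ) : ℝ)) := by
    intro k x hx
    have : ⌈x⌉₊ = k + 1 := by
      rw [Nat.ceil_eq_iff (by omega)]
      exact ⟨by simpa using hx.1, hx.2⟩
    simp [this]
  have hint : ∀ k : ℕ, IntervalIntegrable (fun x : ℝ => h ⌈x⌉₊) volume (k : ℝ) ((k + 1 : ℕ) : ℝ) := by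
    intro k
    rw [intervalIntegrable_iff_integrableOn_Ioc_of_le (by simp)]
    exact (integrableOn_const (by simp)).congr_fun (h1 k).symm measurableSet_Ioc
  have h2 := intervalIntegral.sum_integral_adjacent_intervals (f := fun x : ℝ => h ⌈x⌉₊)
    (a := fun k : ℕ => (k : ℝ)) (n := n) (fun k _ => hint k)
  rw [Nat.cast_zero] at h2
  rw [← intervalIntegral.integral_of_le (by positivity), ← h2]
  clear h2
  induction n with
  | zero => simp
  | succ n ih =>
    rw [Finset.sum_range_succ, ih, Finset.sum_Icc_succ_top (by omega),
      intervalIntegral.integral_of_le (by simp), setIntegral_congr_fun measurableSet_Ioc (h1 n)]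
    simp

/-- Sums of sequences of power growth against ratios of binomial coefficients. -/
lemma tendsto_sum_mul_centralRatio {w : ℕ → ℝ} {c a : ℝ} (ha : -1 < a) (ha1 : a ≤ 1)
    (hw : Tendsto (fun k : ℕ => w k / (k : ℝ) ^ a) atTop (𝓝 c)) :
    Tendsto (fun n : ℕ => (n : ℝ) ^ (-(a + 1) / 2) * ∑ k ∈ Finset.Icc 1 n, w k * centralRatio n k)
      atTop (𝓝 (c * (Real.Gamma ((a + 1) / 2) / 2))) := by
  obtain ⟨C, hC⟩ := hw.abs.bddAbove_range
  have hC' : ∀ k : ℕ, |w k / (k : ℝ) ^ a| ≤ C := fun k => hC ⟨k, rfl⟩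
  have hsq : Tendsto (fun n : ℕ => √(n : ℝ)) atTop atTop :=
    Real.tendsto_sqrt_atTop.comp tendsto_natCast_atTop_atTop
  have hlim : ∫ s in Set.Ioi (0 : ℝ), c * (s ^ a * Real.exp (-s ^ (2 : ℝ))) =
      c * (Real.Gamma ((a + 1) / 2) / 2) := by
    rw [integral_const_mul, integral_rpow_mul_exp_neg_rpow two_pos ha]
    ring
  rw [← hlim]
  -- With K = ⌈√n s⌉ the three factors tend to c, s^a and exp(-s²) separately; the first one is
  -- bounded because the sequence converges.
  have hconv : Tendsto (fun n : ℕ => ∫ s in Set.Ioi (0 : ℝ),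
      w ⌈√n * s⌉₊ / (⌈√n * s⌉₊ : ℝ) ^ a * (((⌈√n * s⌉₊ : ℝ) / √n) ^ a * centralRatio n ⌈√n * s⌉₊))
      atTop (𝓝 (∫ s in Set.Ioi (0 : ℝ), c * (s ^ a * Real.exp (-s ^ (2 : ℝ))))) := by
    refine tendsto_integral_filter_of_dominated_convergence
      -- Since s ≤ K/√n ≤ s + 1, the power (K/√n)^a is at most s^a when a ≤ 0 and at most s + 1 when
      -- 0 ≤ a ≤ 1; the three terms cover both cases.
      (fun s => C * (s ^ a * Real.exp (-(1 / 2) * s ^ 2) + s ^ (1 : ℝ) * Real.exp (-(1 / 2) * s ^ 2) +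
        s ^ (0 : ℝ) * Real.exp (-(1 / 2) * s ^ 2))) ?_ ?_ ?_ ?_
    · refine Eventually.of_forall fun n => Measurable.aestronglyMeasurable ?_
      have h1 : Measurable fun s : ℝ => ⌈√(n : ℝ) * s⌉₊ :=
        Nat.measurable_ceil.comp (by fun_prop)
      exact (measurable_from_nat (f := fun k : ℕ => w k / (k : ℝ) ^ a *
        (((k : ℝ) / √n) ^ a * centralRatio n k))).comp h1
    · filter_upwards [eventually_gt_atTop 0] with n hn
      refine (ae_restrict_mem measurableSet_Ioi).mono fun s hs => ?_
      have hs : 0 < s := hs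
      have hn' : (1 : ℝ) ≤ n := by exact_mod_cast hn
      have hn1 : (1 : ℝ) ≤ √n := by simpa using hn'
      have hnp : (0 : ℝ) < √n := by linarith
      set K := ⌈√n * s⌉₊ with hK
      have hKl : s ≤ K / √n := by
        rw [le_div_iff₀ hnp, mul_comm]; exact Nat.le_ceil _
      have hKu : K / √n ≤ s + 1 := by
        rw [div_le_iff₀ hnp]
        have := Nat.ceil_lt_add_one (a := √(n : ℝ) * s) (by positivity)
        rw [← hK] at this
        nlinarith
      have hpow : (K / √n) ^ a ≤ s ^ a + s ^ (1 : ℝ) + s ^ (0 : ℝ) := by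
        have : 0 < s ^ a := Real.rpow_pos_of_pos hs a
        rw [Real.rpow_one, Real.rpow_zero]
        rcases le_total a 0 with h0 | h0
        · have := Real.rpow_le_rpow_of_nonpos hs hKl h0
          linarith
        · have h1 := Real.rpow_le_rpow (by positivity) hKu h0
          have h2 := Real.rpow_le_rpow_of_exponent_le (by linarith : 1 ≤ s + 1) ha1
          rw [Real.rpow_one] at h2
          linarith
      have hq : centralRatio n K ≤ Real.exp (-(1 / 2) * s ^ 2) := by
        refine (centralRatio_le n K).trans (Real.exp_le_exp.2 ?_)
        have h1 : s ^ 2 ≤ (K / √n) ^ 2 := by gcongr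
        rw [div_pow, Real.sq_sqrt (by positivity)] at h1
        have h2 : (K : ℝ) ^ 2 / (2 * n) = 1 / 2 * (K ^ 2 / n) := by field_simp
        rw [h2]
        linarith
      have hqn := centralRatio_nonneg n K
      have hC0 : 0 ≤ C := (abs_nonneg _).trans (hC' 0)
      rw [norm_mul, Real.norm_eq_abs, norm_mul, Real.norm_eq_abs, Real.norm_eq_abs,
        abs_of_nonneg hqn, abs_of_nonneg (by positivity : (0 : ℝ) ≤ (K / √n) ^ a),
        ← add_mul, ← add_mul]
      gcongr
      exact hC' K
    · have hb : (0 : ℝ) < 1 / 2 := by norm_num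
      exact (((integrableOn_rpow_mul_exp_neg_mul_sq hb ha).add
        (integrableOn_rpow_mul_exp_neg_mul_sq hb (by norm_num : (-1 : ℝ) < 1))).add
        (integrableOn_rpow_mul_exp_neg_mul_sq hb (by norm_num : (-1 : ℝ) < 0))).const_mul C
    · refine (ae_restrict_mem measurableSet_Ioi).mono fun s hs => ?_
      have hs : 0 < s := hs
      have hKtop : Tendsto (fun n : ℕ => ⌈√(n : ℝ) * s⌉₊) atTop atTop :=
        tendsto_nat_ceil_atTop.comp (hsq.atTop_mul_const hs)
      refine (hw.comp hKtop).mul (Tendsto.mul ?_ ?_)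
      · exact (tendsto_ceil_mul_sqrt_div s hs).rpow_const (Or.inl hs.ne')
      · simpa using tendsto_centralRatio s hs
  refine hconv.congr' ?_
  filter_upwards [eventually_gt_atTop 0] with n hn
  have hn' : (0 : ℝ) < n := by exact_mod_cast hn
  have hnp : (0 : ℝ) < √n := by positivity
  -- The integral may run to infinity because the binomial ratio vanishes for k > n.
  have h1 : ∫ x in Set.Ioi (0 : ℝ), w ⌈x⌉₊ * centralRatio n ⌈x⌉₊ =
      ∑ k ∈ Finset.Icc 1 n, w k * centralRatio n k := by
    rw [← integral_comp_ceil]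
    refine setIntegral_eq_of_subset_of_forall_sdiff_eq_zero measurableSet_Ioi
      (fun x hx => hx.1) fun x hx => ?_
    have hx1 : (n : ℝ) < x := by
      by_contra h
      exact hx.2 ⟨hx.1, not_lt.1 h⟩
    rw [centralRatio_eq_zero (by exact_mod_cast hx1.trans_le (Nat.le_ceil x)), mul_zero]
  have h2 := integral_comp_mul_left_Ioi (fun x => w ⌈x⌉₊ * centralRatio n ⌈x⌉₊) 0 hnp
  rw [mul_zero, h1, smul_eq_mul] at h2
  have h3 : ∑ k ∈ Finset.Icc 1 n, w k * centralRatio n k =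
      √n * ∫ s in Set.Ioi (0 : ℝ), w ⌈√n * s⌉₊ * centralRatio n ⌈√n * s⌉₊ := by
    rw [h2]; field_simp
  rw [h3, ← mul_assoc, ← integral_const_mul]
  refine setIntegral_congr_fun measurableSet_Ioi fun s hs => ?_
  have hs : 0 < s := hs
  have hKpos : (0 : ℝ) < ⌈√n * s⌉₊ := by
    exact_mod_cast Nat.ceil_pos.2 (by positivity)
  have h4 : (n : ℝ) ^ (-(a + 1) / 2) * √n = (√n ^ a)⁻¹ := by
    rw [Real.sqrt_eq_rpow, ← Real.rpow_mul hn'.le, ← Real.rpow_neg hn'.le, ← Real.rpow_add hn']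
    congr 1
    ring
  have h5 : (0 : ℝ) < (⌈√n * s⌉₊ : ℝ) ^ a := Real.rpow_pos_of_pos hKpos a
  rw [h4, Real.div_rpow hKpos.le hnp.le]
  field_simp

/-- Stirling: this is the quotient of the Stirling sequence at 2n by its square at n, with limit √π
/ π. -/
lemma tendsto_sqrt_mul_choose_div_four_pow :
    Tendsto (fun n : ℕ => √n * ((2 * n).choose n / 4 ^ n : ℝ)) atTop (𝓝 (1 / √Real.pi)) := by
  have h1 := Stirling.tendsto_stirlingSeq_sqrt_pi
  have h2 := h1.comp (tendsto_id.const_mul_atTop' (two_pos : 0 < 2))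
  have hp : √Real.pi ≠ 0 := by positivity
  have h3 := h2.div (h1.pow 2) (by positivity)
  rw [show √Real.pi / √Real.pi ^ 2 = 1 / √Real.pi by field_simp] at h3
  refine h3.congr' ?_
  filter_upwards [eventually_gt_atTop 0] with n hn
  have hn' : (0 : ℝ) < n := by exact_mod_cast hn
  have hc : ((2 * n).choose n : ℝ) = (2 * n).factorial / (n.factorial * n.factorial) := by
    rw [Nat.cast_choose ℝ (by omega : n ≤ 2 * n), show 2 * n - n = n by omega]
  have hf : (n.factorial : ℝ) ≠ 0 := by positivity
  have hsq : √(n : ℝ) * √(n : ℝ) = n := Real.mul_self_sqrt hn'.le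
  have hsq0 : √(n : ℝ) ≠ 0 := by positivity
  have h2n : √(2 * (2 * n : ℝ)) = 2 * √(n : ℝ) := by
    rw [← mul_assoc, Real.sqrt_mul (by norm_num), show (2 * 2 : ℝ) = 2 ^ 2 by norm_num,
      Real.sqrt_sq (by norm_num)]
  have h4 : (4 : ℝ) ^ n = 2 ^ (2 * n) := by rw [pow_mul]; norm_num
  have h22 : √(2 * n : ℝ) ^ 2 = 2 * n := Real.sq_sqrt (by positivity)
  simp only [Pi.div_apply, Function.comp_apply, Stirling.stirlingSeq, id]
  rw [hc, h4, div_pow _ (√(2 * (n : ℝ)) * _), mul_pow √(2 * (n : ℝ)), h22, ← pow_mul]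
  push_cast
  rw [h2n, show (2 * n / Real.exp 1 : ℝ) ^ (2 * n) = 2 ^ (2 * n) * (n / Real.exp 1) ^ (2 * n) by
    rw [← mul_pow]; congr 1; ring, mul_comm n 2]
  have h5 : (n / Real.exp 1 : ℝ) ^ (2 * n) ≠ 0 := by positivity
  generalize (n / Real.exp 1 : ℝ) ^ (2 * n) = z at h5 ⊢
  field_simp
  linear_combination -hsq

/-- Asymptotics of a sum of powers of three, walk counts and binomial coefficients. -/
lemma tendsto_sum_centralTrinomial_mul_choose {a : ℝ} (ha : -1 < a) (ha1 : a ≤ 1) :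
    Tendsto (fun n : ℕ => (n : ℝ) ^ (-a / 2) / 12 ^ n * ∑ k ∈ Finset.Icc 1 n,
      (k : ℝ) ^ (a + 1 / 2) * (centralTrinomial k * 3 ^ (n - k) * (2 * n).choose (n + k))) atTop
      (𝓝 (√3 * Real.Gamma ((a + 1) / 2) / (4 * Real.pi))) := by
  have hw : Tendsto (fun k : ℕ => (k : ℝ) ^ (a + 1 / 2) * (centralTrinomial k / 3 ^ k) / (k : ℝ) ^ a)
      atTop (𝓝 (√3 / (2 * √Real.pi))) := by
    refine tendsto_sqrt_mul_centralTrinomial.congr' ?_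
    filter_upwards [eventually_gt_atTop 0] with k hk
    have hk' : (0 : ℝ) < k := by exact_mod_cast hk
    have := Real.rpow_pos_of_pos hk' a
    rw [Real.rpow_add hk', Real.sqrt_eq_rpow]
    field_simp
  have h1 := (tendsto_sum_mul_centralRatio ha ha1 hw).mul tendsto_sqrt_mul_choose_div_four_pow
  refine (h1.congr' ?_).trans_eq ?_
  · filter_upwards [eventually_gt_atTop 0] with n hn
    have hn' : (0 : ℝ) < n := by exact_mod_cast hn
    have hc : ((2 * n).choose n : ℝ) ≠ 0 := by
      exact_mod_cast (Nat.choose_pos (by omega : n ≤ 2 * n)).ne'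
    have h2 : (n : ℝ) ^ (-(a + 1) / 2) * √n = (n : ℝ) ^ (-a / 2) := by
      rw [Real.sqrt_eq_rpow, ← Real.rpow_add hn']
      congr 1
      ring
    rw [← h2, Finset.mul_sum, Finset.mul_sum, Finset.sum_mul]
    refine Finset.sum_congr rfl fun k hk => ?_
    have hkn : k ≤ n := (Finset.mem_Icc.1 hk).2
    have h3 : (12 : ℝ) ^ n = 3 ^ k * 3 ^ (n - k) * 4 ^ n := by
      rw [← pow_add, Nat.add_sub_cancel' hkn, ← mul_pow]; norm_num
    rw [centralRatio, h3]
    field_simp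
  · congr 1
    have h : √Real.pi * √Real.pi = Real.pi := Real.mul_self_sqrt Real.pi_pos.le
    rw [div_mul_div_comm, div_mul_div_comm, mul_one]
    congr 1
    linear_combination 4 * h

/-- Case a = -1/2, in which the weight k^(a + 1/2) is trivial. -/
lemma isEquivalent_sum_centralTrinomial_mul_choose :
    Asymptotics.IsEquivalent atTop
      (fun n : ℕ => 2 * ∑ k ∈ Finset.Icc 1 n,
        (centralTrinomial k * 3 ^ (n - k) * (2 * n).choose (n + k) : ℝ))
      (fun n : ℕ => √3 * Real.Gamma (1 / 4) * 12 ^ n / (2 * Real.pi * (n : ℝ) ^ (1 / 4 : ℝ))) := by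
  have hΓ : 0 < Real.Gamma (1 / 4) := Real.Gamma_pos_of_pos (by norm_num)
  have hp := Real.pi_pos
  have h := tendsto_sum_centralTrinomial_mul_choose (a := -1 / 2) (by norm_num) (by norm_num)
  refine Asymptotics.isEquivalent_of_tendsto_one ?_
  have h' := h.div_const (√3 * Real.Gamma (1 / 4) / (4 * Real.pi))
  rw [show ((-1 / 2 + 1) / 2 : ℝ) = 1 / 4 by norm_num, div_self (by positivity)] at h'
  refine h'.congr' ?_
  filter_upwards [eventually_gt_atTop 0] with n hn
  have hn' : (0 : ℝ) < n := by exact_mod_cast hn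
  have hpow : (0 : ℝ) < (n : ℝ) ^ (1 / 4 : ℝ) := by positivity
  rw [show (-(-1 / 2) / 2 : ℝ) = 1 / 4 by norm_num]
  simp only [show (-1 / 2 + 1 / 2 : ℝ) = 0 by norm_num, Real.rpow_zero, one_mul, Pi.div_apply]
  field_simp
  ring

/-- Case a = 1/2, in which the weight is k; the prefactor 1/n turns the growth n^(1/4) into
n^(-3/4). -/
lemma isEquivalent_sum_mul_centralTrinomial_mul_choose :
    Asymptotics.IsEquivalent atTop
      (fun n : ℕ => (1 / n : ℝ) * ∑ k ∈ Finset.Icc 1 n,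
        (k * (centralTrinomial k * 3 ^ (n - k) * (2 * n).choose (n + k)) : ℝ))
      (fun n : ℕ => √3 * Real.Gamma (3 / 4) * 12 ^ n / (4 * Real.pi * (n : ℝ) ^ (3 / 4 : ℝ))) := by
  have hΓ : 0 < Real.Gamma (3 / 4) := Real.Gamma_pos_of_pos (by norm_num)
  have hp := Real.pi_pos
  have h := tendsto_sum_centralTrinomial_mul_choose (a := 1 / 2) (by norm_num) (by norm_num)
  refine Asymptotics.isEquivalent_of_tendsto_one ?_
  have h' := h.div_const (√3 * Real.Gamma (3 / 4) / (4 * Real.pi))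
  rw [show ((1 / 2 + 1) / 2 : ℝ) = 3 / 4 by norm_num, div_self (by positivity)] at h'
  refine h'.congr' ?_
  filter_upwards [eventually_gt_atTop 0] with n hn
  have hn' : (0 : ℝ) < n := by exact_mod_cast hn
  have hpow : (0 : ℝ) < (n : ℝ) ^ (3 / 4 : ℝ) := by positivity
  have h2 : (n : ℝ) ^ (-(1 / 2) / 2 : ℝ) = (n : ℝ) ^ (3 / 4 : ℝ) / n := by
    rw [eq_div_iff hn'.ne', ← Real.rpow_add_one hn'.ne']
    norm_num
  rw [h2]
  simp only [show (1 / 2 + 1 / 2 : ℝ) = 1 by norm_num, Real.rpow_one, Pi.div_apply]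
  field_simp

/-! ### Elementary properties of rotation systems -/

namespace CombMap

variable {D : Type} (m : CombMap D)

lemma leftFace_eq_iff {d d' : D} : m.leftFace d = m.leftFace d' ↔ m.faceNext.SameCycle d d' :=
  ⟨fun h => Quotient.exact h, fun h => Quotient.sound h⟩

lemma rev_zpow (d : D) (i : ℤ) : (m.rev ^ i) d = d ∨ (m.rev ^ i) d = m.rev d := by
  have h : m.rev * m.rev = 1 := Equiv.ext m.rev_rev
  have h2 : m.rev ^ (2 : ℤ) = 1 := by rw [zpow_two, h]
  rcases Int.even_or_odd' i with ⟨j, rfl | rfl⟩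
  · left; rw [zpow_mul, h2, one_zpow]; rfl
  · right; rw [zpow_add, zpow_mul, h2, one_zpow]; simp

lemma edge_eq_iff {d d' : D} : m.edge d = m.edge d' ↔ d' = d ∨ d' = m.rev d := by
  constructor
  · intro h
    obtain ⟨i, hi⟩ : m.rev.SameCycle d d' := Quotient.exact h
    rw [← hi]
    exact m.rev_zpow d i
  · rintro (rfl | rfl)
    · rfl
    · exact Quotient.sound ⟨1, by simp⟩

@[simp] lemma edge_rev (d : D) : m.edge (m.rev d) = m.edge d :=
  (m.edge_eq_iff.2 (Or.inr rfl)).symm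

@[simp] lemma target_rev (d : D) : m.target (m.rev d) = m.origin d := by
  rw [target, m.rev_rev]

@[simp] lemma origin_rev (d : D) : m.origin (m.rev d) = m.target d := rfl

@[simp] lemma rightFace_rev (d : D) : m.rightFace (m.rev d) = m.leftFace d := by
  rw [rightFace, m.rev_rev]

@[simp] lemma leftFace_rev (d : D) : m.leftFace (m.rev d) = m.rightFace d := rfl

@[simp] lemma origin_rot (d : D) : m.origin (m.rot d) = m.origin d :=
  Quotient.sound (Equiv.Perm.SameCycle.symm ⟨1, by simp⟩)

@[simp] lemma leftFace_faceNext (d : D) : m.leftFace (m.faceNext d) = m.leftFace d :=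
  Quotient.sound (Equiv.Perm.SameCycle.symm ⟨1, by simp⟩)

@[simp] lemma origin_faceNext (d : D) : m.origin (m.faceNext d) = m.target d := by
  rw [faceNext, Equiv.Perm.mul_apply, origin_rot]; rfl

lemma rot_eq (d : D) : m.rot d = m.faceNext (m.rev d) := by
  rw [faceNext, Equiv.Perm.mul_apply, m.rev_rev]

lemma origin_surjective : Function.Surjective m.origin := Quotient.mk_surjective

lemma leftFace_surjective : Function.Surjective m.leftFace := Quotient.mk_surjective

lemma edge_surjective : Function.Surjective m.edge := Quotient.mk_surjective

instance [Finite D] : Finite m.Vertex := Finite.of_surjective _ m.origin_surjective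
instance [Finite D] : Finite m.Face := Finite.of_surjective _ m.leftFace_surjective
instance [Finite D] : Finite m.Edge := Finite.of_surjective _ m.edge_surjective

/-- A property of darts which is invariant under `rev` and `rot` holds everywhere as soon as it holds
somewhere. -/
lemma induction_on [Finite D] {P : D → Prop} (d₀ : D) (h₀ : P d₀) (hrev : ∀ d, P d → P (m.rev d))
    (hrot : ∀ d, P d → P (m.rot d)) (d : D) : P d := by
  obtain ⟨g, hg, rfl⟩ := m.connected d₀ d
  have key : ∀ g ∈ Subgroup.closure ({m.rev, m.rot} : Set (Equiv.Perm D)), ∀ x, P x ↔ P (g x) := by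
    intro g hg
    refine Subgroup.closure_induction (p := fun g _ => ∀ x, P x ↔ P (g x)) ?_ ?_ ?_ ?_ hg
    · intro f hf
      have aux : ∀ f : Equiv.Perm D, (∀ x, P x → P (f x)) → ∀ x, P x ↔ P (f x) := by
        intro f hf x
        refine ⟨hf x, fun h => ?_⟩
        -- For the converse implication, `f` is applied further until its finite order brings `f x`
        -- back to `x`.
        have hn : ∀ n : ℕ, P ((f ^ n) (f x)) := by
          intro n
          induction n with
          | zero => simpa using h
          | succ n ih => rw [pow_succ', Equiv.Perm.mul_apply]; exact hf _ ih
        obtain ⟨n, hn0, hn1⟩ := (isOfFinOrder_of_finite f).exists_pow_eq_one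
        have := hn (n - 1)
        rwa [← Equiv.Perm.mul_apply, ← pow_succ, Nat.sub_add_cancel hn0, hn1] at this
      rcases hf with rfl | rfl
      · exact aux _ hrev
      · exact aux _ hrot
    · simp
    · intro f g _ _ hf hg x
      rw [hg x, hf (g x)]; rfl
    · intro f _ hf x
      rw [hf (f⁻¹ x)]; simp
  exact (key g hg d₀).1 h₀

lemma nonempty_vertex [Nonempty D] : Nonempty m.Vertex := ⟨m.origin (Classical.arbitrary D)⟩

/-- A function on vertices with vanishing differences along all edges is constant. -/
lemma eq_of_forall_target_eq [Finite D] {α : Type*} (f : m.Vertex → α)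
    (h : ∀ d, f (m.target d) = f (m.origin d)) (x y : m.Vertex) : f x = f y := by
  obtain ⟨a, rfl⟩ := m.origin_surjective x
  obtain ⟨b, rfl⟩ := m.origin_surjective y
  symm
  refine m.induction_on (P := fun d => f (m.origin d) = f (m.origin a)) a rfl ?_ ?_ b
  · intro d hd; rw [origin_rev, h, hd]
  · intro d hd; rw [origin_rot, hd]

/-! ### Gradients, circulations and planarity -/

/-- The gradient of a function on vertices. -/
def grad : (m.Vertex → ℚ) →ₗ[ℚ] (D → ℚ) where
  toFun f d := f (m.target d) - f (m.origin d)
  map_add' f g := by ext d; simp; ring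
  map_smul' c f := by ext d; simp; ring

@[simp] lemma grad_apply (f : m.Vertex → ℚ) (d : D) :
    m.grad f d = f (m.target d) - f (m.origin d) := rfl

/-- The antisymmetric functions on darts. -/
def antisymm : Submodule ℚ (D → ℚ) where
  carrier := {δ | ∀ d, δ (m.rev d) = -δ d}
  add_mem' h h' d := by simp [h d, h' d]; ring
  zero_mem' := by simp
  smul_mem' c δ h d := by simp [h d]

lemma grad_mem_antisymm (f : m.Vertex → ℚ) : m.grad f ∈ m.antisymm := by
  intro d; simp

/-- By connectedness the kernel consists of the constant functions. -/
lemma finrank_range_grad [Finite D] [Nonempty D] :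
    Module.finrank ℚ (LinearMap.range m.grad) + 1 = Nat.card m.Vertex := by
  classical
  have := Fintype.ofFinite m.Vertex
  have hN := m.nonempty_vertex
  have hker : LinearMap.ker m.grad = Submodule.span ℚ {fun _ => (1 : ℚ)} := by
    ext f
    rw [LinearMap.mem_ker, Submodule.mem_span_singleton]
    constructor
    · intro h
      refine ⟨f (Classical.arbitrary _), funext fun x => ?_⟩
      have := m.eq_of_forall_target_eq f (fun d => by
        have := congrFun h d
        simpa [sub_eq_zero] using this) x (Classical.arbitrary _)
      simp [this]
    · rintro ⟨c, rfl⟩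
      ext d
      simp
  have h1 : Module.finrank ℚ (LinearMap.ker m.grad) = 1 := by
    rw [hker]
    refine finrank_span_singleton ?_
    intro h
    have := congrFun h (Classical.arbitrary _)
    simp at this
  rw [← h1, LinearMap.finrank_range_add_finrank_ker, Module.finrank_fintype_fun_eq_card,
    Nat.card_eq_fintype_card]

/-- A choice of one dart on each edge gives coordinates on antisymmetric functions. -/
lemma finrank_antisymm [Finite D] : Module.finrank ℚ m.antisymm = Nat.card m.Edge := by
  classical
  have := Fintype.ofFinite m.Edge
  have hout : ∀ e : m.Edge, m.edge e.out = e := fun e => Quotient.out_eq e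
  let F : m.antisymm →ₗ[ℚ] (m.Edge → ℚ) :=
    { toFun := fun δ e => δ.1 e.out
      map_add' := fun _ _ => rfl
      map_smul' := fun _ _ => rfl }
  have hF : Function.Bijective F := by
    constructor
    · rw [← LinearMap.ker_eq_bot, LinearMap.ker_eq_bot']
      intro δ h
      ext d
      have h1 : δ.1 (m.edge d).out = 0 := congrFun h (m.edge d)
      rcases m.edge_eq_iff.1 (hout (m.edge d)) with h2 | h2
      · rw [h2, h1]; rfl
      · rw [h2, δ.2, h1]; simp
    · intro g
      refine ⟨⟨fun d => if (m.edge d).out = d then g (m.edge d) else -g (m.edge d), fun d => ?_⟩,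
        funext fun e => ?_⟩
      · simp only [edge_rev]
        have hne := m.rev_ne d
        rcases m.edge_eq_iff.1 (hout (m.edge d)) with h2 | h2
        · rw [if_neg, if_pos h2.symm]
          rw [← h2]; exact hne.symm
        · rw [if_pos, if_neg, neg_neg]
          · intro h3; rw [h3] at h2; exact hne h2.symm
          · conv_rhs => rw [h2]
            rw [m.rev_rev]
      · simp [F, hout]
  rw [(LinearEquiv.ofBijective F hF).finrank_eq, Module.finrank_fintype_fun_eq_card,
    Nat.card_eq_fintype_card]

lemma sum_eq_sum_edge [Fintype D] [Fintype m.Edge] {R : Type*} [AddCommMonoid R] {o : m.Edge → D}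
    (ho : ∀ e, m.edge (o e) = e) (F : D → R) : ∑ d, F d = ∑ e, (F (o e) + F (m.rev (o e))) := by
  classical
  rw [← Finset.sum_fiberwise _ m.edge]
  refine Finset.sum_congr rfl fun e _ => ?_
  have : (Finset.univ.filter fun d => m.edge d = e) = {o e, m.rev (o e)} := by
    ext d
    have := m.edge_eq_iff (d := o e) (d' := d)
    rw [ho] at this
    simp [← this, eq_comm]
  rw [this, Finset.sum_pair (m.rev_ne _).symm]

lemma two_mul_card_edge [Finite D] : 2 * Nat.card m.Edge = Nat.card D := by
  classical
  have := Fintype.ofFinite D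
  have := Fintype.ofFinite m.Edge
  have := m.sum_eq_sum_edge (o := Quotient.out) (fun e => Quotient.out_eq e) fun _ => 1
  simp only [Finset.sum_const, Finset.card_univ, smul_eq_mul] at this
  rw [Nat.card_eq_fintype_card, Nat.card_eq_fintype_card]
  omega

/-- Gradients have zero circulation along each face. -/
lemma sum_leftFace_grad [Fintype D] [DecidableEq m.Face] {f₀ : m.Face} (f : m.Vertex → ℚ) :
    ∑ d with m.leftFace d = f₀, m.grad f d = 0 := by
  simp only [grad_apply, Finset.sum_sub_distrib, sub_eq_zero]
  -- The next dart of the face starts at the target of `d`, so the sums over targets and over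
  -- origins agree.
  refine Finset.sum_bij (fun d _ => m.faceNext d) ?_ ?_ ?_ ?_
  · intro d hd; simpa using hd
  · intro a _ b _ h; exact m.faceNext.injective h
  · intro b hb
    refine ⟨m.faceNext.symm b, ?_, by simp⟩
    rw [Finset.mem_filter] at hb ⊢
    rw [← hb.2, ← m.leftFace_faceNext, Equiv.apply_symm_apply]
    simp
  · intro d _; simp

/-- The circulation along a face. -/
def circulation [Fintype D] [DecidableEq m.Face] (f₀ : m.Face) : m.antisymm →ₗ[ℚ] ℚ where
  toFun δ := ∑ d with m.leftFace d = f₀, δ.1 d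
  map_add' δ δ' := by simp [Finset.sum_add_distrib]
  map_smul' c δ := by simp [Finset.mul_sum]

/-- The antisymmetric function which is supported on a single edge. -/
def single [DecidableEq D] (d₀ : D) : D → ℚ :=
  fun d => (if d = d₀ then 1 else 0) - (if d = m.rev d₀ then 1 else 0)

lemma single_mem_antisymm [DecidableEq D] (d₀ : D) : m.single d₀ ∈ m.antisymm := by
  intro d
  have h1 : m.rev d = d₀ ↔ d = m.rev d₀ :=
    ⟨fun h => by rw [← h, m.rev_rev], fun h => by rw [h, m.rev_rev]⟩
  have h2 : m.rev d = m.rev d₀ ↔ d = d₀ := m.rev.injective.eq_iff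
  simp only [single, h1, h2]
  ring

lemma circulation_single [Fintype D] [DecidableEq D] [DecidableEq m.Face] (f₀ : m.Face) (d₀ : D) :
    ∑ d with m.leftFace d = f₀, m.single d₀ d =
      (if m.leftFace d₀ = f₀ then 1 else 0) - (if m.rightFace d₀ = f₀ then 1 else 0) := by
  simp only [single, Finset.sum_sub_distrib, Finset.sum_ite_eq', Finset.mem_filter,
    Finset.mem_univ, true_and]
  rfl

end CombMap

namespace Unicycle

variable {D : Type} (u : Unicycle D)

lemma not_eq_internal_iff {f : u.Face} : f ≠ u.internal ↔ f = u.external := by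
  rcases u.eq_or_eq f with h | h
  · simp [h, u.internal_ne_external]
  · simp [h, u.internal_ne_external.symm]

lemma not_eq_external_iff {f : u.Face} : f ≠ u.external ↔ f = u.internal := by
  rcases u.eq_or_eq f with h | h
  · simp [h, u.internal_ne_external]
  · simp [h, u.internal_ne_external.symm]

lemma card_face : Nat.card u.Face = 2 := by
  rw [Nat.card_eq_two_iff]
  exact ⟨_, _, u.internal_ne_external, Set.eq_univ_of_forall fun f => u.eq_or_eq f⟩

end Unicycle

namespace CombMap

variable {D : Type} (m : CombMap D)

/-- Some edge separates any given face of a map with at least two faces from the other faces. -/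
lemma exists_separating_dart [Finite D] {f g : m.Face} (hfg : f ≠ g) :
    ∃ d, m.leftFace d = f ∧ m.rightFace d ≠ f := by
  by_contra! h
  obtain ⟨a, rfl⟩ := m.leftFace_surjective f
  obtain ⟨b, rfl⟩ := m.leftFace_surjective g
  refine hfg (m.induction_on (P := fun d => m.leftFace d = m.leftFace a) a rfl ?_ ?_ b).symm
  · intro d hd; exact h d hd
  · intro d hd
    rw [rot_eq, leftFace_faceNext]; exact h d hd

/-- A map with two faces is planar if and only if the antisymmetric functions with zero
circulation along a face are the gradients. -/
lemma isPlanar_iff_of_two_faces [Fintype D] [DecidableEq m.Face] (h2 : Nat.card m.Face = 2)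
    (f₀ : m.Face) : m.IsPlanar ↔
      ∀ δ ∈ m.antisymm, ∑ d with m.leftFace d = f₀, δ d = 0 → ∃ f, m.grad f = δ := by
  classical
  have hD : Nonempty D := let ⟨d, _⟩ := m.leftFace_surjective f₀; ⟨d⟩
  -- A dart with `f₀` on its left only carries an antisymmetric function of circulation 1.
  have hsurj : Function.Surjective (m.circulation f₀) := by
    refine LinearMap.surjective fun h0 => ?_
    obtain ⟨g, hg⟩ : ∃ g : m.Face, f₀ ≠ g := by
      have : Nontrivial m.Face := Finite.one_lt_card_iff_nontrivial.1 (by omega)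
      obtain ⟨g, hg⟩ := exists_ne f₀
      exact ⟨g, hg.symm⟩
    obtain ⟨d, hd, hd'⟩ := m.exists_separating_dart hg
    have h1 := m.circulation_single f₀ d
    rw [if_pos hd, if_neg hd', sub_zero] at h1
    have h3 : m.circulation f₀ ⟨m.single d, m.single_mem_antisymm d⟩ = 1 := h1
    rw [h0] at h3
    simp at h3
  have hdim := LinearMap.finrank_range_add_finrank_ker (m.circulation f₀)
  rw [LinearMap.range_eq_top.2 hsurj, finrank_top, Module.finrank_self, finrank_antisymm] at hdim
  set K := (LinearMap.ker (m.circulation f₀)).map m.antisymm.subtype with hK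
  have hKmem : ∀ δ, δ ∈ K ↔ δ ∈ m.antisymm ∧ ∑ d with m.leftFace d = f₀, δ d = 0 := by
    intro δ
    rw [hK, Submodule.mem_map]
    constructor
    · rintro ⟨δ, h, rfl⟩; exact ⟨δ.2, h⟩
    · rintro ⟨h, h'⟩; exact ⟨⟨δ, h⟩, h', rfl⟩
  have hKdim : Module.finrank ℚ K = Module.finrank ℚ (LinearMap.ker (m.circulation f₀)) :=
    (Submodule.equivMapOfInjective _ (Submodule.injective_subtype _) _).finrank_eq.symm
  have hle : LinearMap.range m.grad ≤ K := by
    rintro _ ⟨f, rfl⟩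
    exact (hKmem _).2 ⟨m.grad_mem_antisymm f, m.sum_leftFace_grad f⟩
  have hr := m.finrank_range_grad
  -- The gradients form a subspace of `K`, of dimension V - 1 against E - 1, and Euler's formula
  -- with two faces says V = E.
  have hiff : m.IsPlanar ↔ K ≤ LinearMap.range m.grad := by
    rw [IsPlanar, h2]
    constructor
    · intro h
      exact (Submodule.eq_of_le_of_finrank_eq hle (by omega)).ge
    · intro h
      have := congrArg (fun S : Submodule ℚ (D → ℚ) => Module.finrank ℚ S) (le_antisymm hle h)
      omega
  rw [hiff]
  constructor
  · intro h δ h1 h2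
    exact h ((hKmem δ).2 ⟨h1, h2⟩)
  · intro h δ hδ
    obtain ⟨h1, h2⟩ := (hKmem δ).1 hδ
    exact h δ h1 h2

end CombMap

namespace Unicycle

variable {D : Type} (u : Unicycle D)

/-- In a unicycle, the antisymmetric functions with zero circulation along a face are gradients. -/
lemma exists_grad_eq [Fintype D] [DecidableEq u.Face] (f₀ : u.Face) {δ : D → ℚ}
    (h : ∀ d, δ (u.rev d) = -δ d) (h0 : ∑ d with u.leftFace d = f₀, δ d = 0) :
    ∃ f, u.grad f = δ :=
  (u.isPlanar_iff_of_two_faces u.card_face f₀).1 u.planar δ h h0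

end Unicycle

/-! ### Cycle edges are the edges with different faces on their two sides -/

namespace CombMap

variable {D : Type} (m : CombMap D)

/-- The underlying simple graph of the map, after deletion of the edge of `d₀`. -/
def graphDelete (d₀ : D) : SimpleGraph m.Vertex where
  Adj x y := x ≠ y ∧ ∃ d, m.origin d = x ∧ m.target d = y ∧ m.edge d ≠ m.edge d₀
  symm := ⟨fun _ _ ⟨hne, d, h1, h2, h3⟩ => ⟨hne.symm, m.rev d, by simpa, by simpa, by simpa⟩⟩
  loopless := ⟨fun _ h => h.1 rfl⟩

/-- An edge lies on a cycle if its end points remain connected after its deletion. -/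
lemma onCycle_of_reachable {d : D} (h : (m.graphDelete d).Reachable (m.target d) (m.origin d)) :
    m.OnCycle d := by
  classical
  obtain ⟨p, hp⟩ := h.exists_isPath
  have hadj : ∀ i : Fin p.length, ∃ d', m.origin d' = p.getVert i ∧
      m.target d' = p.getVert (i + 1) ∧ m.edge d' ≠ m.edge d := fun i =>
    (p.adj_getVert_succ i.2).2
  choose c hc1 hc2 hc3 using hadj
  have hinj : ∀ i j : ℕ, i ≤ p.length → j ≤ p.length → p.getVert i = p.getVert j → i = j :=
    fun i j hi hj h => hp.getVert_injOn hi hj h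
  have hlast : p.getVert p.length = m.origin d := p.getVert_length
  -- The cycle is `d` followed by a path from its target back to its origin that avoids its edge;
  -- the empty path corresponds to a loop.
  refine ⟨p.length, Fin.cons d c, ⟨?_, ?_, ?_⟩, 0, rfl⟩
  · have horig : ∀ (j : ℕ) (hj : j < p.length + 1), j ≠ 0 →
        m.origin ((Fin.cons d c : Fin (p.length + 1) → D) ⟨j, hj⟩) = p.getVert (j - 1) := by
      intro j hj hj0
      obtain ⟨j, rfl⟩ := Nat.exists_eq_succ_of_ne_zero hj0
      exact hc1 ⟨j, by omega⟩
    intro i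
    have htarget : m.target ((Fin.cons d c : Fin (p.length + 1) → D) i) = p.getVert i := by
      refine Fin.cases ?_ (fun i => ?_) i
      · simp
      · rw [Fin.cons_succ, hc2]; simp
    rw [htarget]
    rcases eq_or_ne i (Fin.last _) with rfl | hi
    · simp only [Fin.last_add_one, Fin.cons_zero, Fin.val_last, hlast]
    · have hval : ((i + 1 : Fin (p.length + 1)) : ℕ) = i + 1 :=
        Fin.val_add_one_of_lt (Fin.lt_last_iff_ne_last.2 hi)
      have := horig _ (i + 1 : Fin (p.length + 1)).2 (by omega)
      rw [Fin.eta] at this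
      rw [this, hval, Nat.add_sub_cancel]
  · intro i j h
    induction i using Fin.cases with
    | zero =>
      induction j using Fin.cases with
      | zero => rfl
      | succ j =>
        simp only [Fin.cons_zero, Fin.cons_succ, hc1, ← hlast] at h
        have := hinj _ _ le_rfl j.2.le h
        omega
    | succ i =>
      induction j using Fin.cases with
      | zero =>
        simp only [Fin.cons_zero, Fin.cons_succ, hc1, ← hlast] at h
        have := hinj _ _ i.2.le le_rfl h
        omega
      | succ j =>
        simp only [Fin.cons_succ, hc1] at h
        have := hinj _ _ i.2.le j.2.le h
        rw [Fin.ext this]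
  · intro i j h
    induction i using Fin.cases with
    | zero =>
      induction j using Fin.cases with
      | zero => rfl
      | succ j => exact absurd h.symm (hc3 j)
    | succ i =>
      induction j using Fin.cases with
      | zero => exact absurd h (hc3 i)
      | succ j =>
        simp only [Fin.cons_succ] at h
        have hi := i.2
        have hj := j.2
        -- Equal darts have equal origins, while opposite darts would force j = i + 1 and j + 1 = i.
        rcases m.edge_eq_iff.1 h with h1 | h1
        · have := hinj j i hj.le hi.le (by rw [← hc1, ← hc1, h1])
          rw [Fin.ext this]
        · have h2 := hinj j (i + 1) hj.le hi (by rw [← hc1, ← hc2, h1, origin_rev])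
          have h3 := hinj (j + 1) i hj hi.le (by rw [← hc1, ← hc2, h1, target_rev])
          omega

end CombMap

namespace Unicycle

variable {D : Type} (u : Unicycle D)

/-- If deleting the edge separated its ends, the indicator of the component of the target would have
gradient `single d`. That function has circulation 1 along the left face when the right face
differs, whereas gradients have circulation 0. -/
lemma onCycle_of_leftFace_ne_rightFace [Finite D] {d : D} (h : u.leftFace d ≠ u.rightFace d) :
    u.OnCycle d := by
  classical
  have := Fintype.ofFinite D
  refine u.onCycle_of_reachable ?_
  by_contra hr
  set f : u.Vertex → ℚ := fun x => if (u.graphDelete d).Reachable (u.target d) x then 1 else 0 with hf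
  have hgrad : u.grad f = u.single d := by
    ext d'
    by_cases he : u.edge d = u.edge d'
    · have hne := u.rev_ne d
      rcases u.edge_eq_iff.1 he with rfl | rfl
      · simp [hf, hr, CombMap.single, hne.symm]
      · simp [hf, hr, CombMap.single, hne]
    · have h1 : d' ≠ d := fun h => he (by rw [h])
      have h2 : d' ≠ u.rev d := fun h => he (by rw [h, u.edge_rev])
      have h3 : (u.graphDelete d).Reachable (u.target d) (u.target d') ↔
          (u.graphDelete d).Reachable (u.target d) (u.origin d') := by
        by_cases heq : u.origin d' = u.target d'
        · rw [heq]
        · have hadj : (u.graphDelete d).Adj (u.origin d') (u.target d') :=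
            ⟨heq, d', rfl, rfl, Ne.symm he⟩
          exact ⟨fun h => h.trans hadj.symm.reachable, fun h => h.trans hadj.reachable⟩
      simp [hf, h3, CombMap.single, h1, h2]
  have h0 := u.sum_leftFace_grad (f₀ := u.leftFace d) f
  rw [hgrad] at h0
  rw [u.circulation_single, if_pos rfl, if_neg h.symm] at h0
  simp at h0

/-- With the same face on both sides, `single d` has zero circulation and is a gradient by
planarity. Its sum around any cycle is then 0, but a cycle through the edge uses it exactly once, so
the sum is ±1. -/
lemma leftFace_ne_rightFace_of_onCycle [Finite D] {d : D} (h : u.OnCycle d) :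
    u.leftFace d ≠ u.rightFace d := by
  classical
  have := Fintype.ofFinite D
  intro hface
  obtain ⟨f, hf⟩ := u.exists_grad_eq u.external (u.single_mem_antisymm d) (by
    rw [u.circulation_single, hface, sub_self])
  obtain ⟨k, c, ⟨hc1, -, hc3⟩, i, hi⟩ := h
  have hsum : ∑ j, u.single d (c j) = 0 := by
    rw [← hf]
    simp only [CombMap.grad_apply, hc1, Finset.sum_sub_distrib, sub_eq_zero]
    exact Equiv.sum_comp (Equiv.addRight (1 : Fin (k + 1))) fun j => f (u.origin (c j))
  rw [Finset.sum_eq_single i] at hsum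
  · have hne := u.rev_ne d
    rcases u.edge_eq_iff.1 hi.symm with h1 | h1
    · simp [CombMap.single, h1, hne.symm] at hsum
    · simp [CombMap.single, h1, hne] at hsum
  · intro j _ hj
    have h1 : c j ≠ d := fun h => hj (hc3 (by simp only [h, hi]))
    have h2 : c j ≠ u.rev d := fun h => hj (hc3 (by simp only [h, hi, u.edge_rev]))
    simp [CombMap.single, h1, h2]
  · simp

/-- The darts of the cycle, with the orientation for which the external face is on the right. -/
def IsCycleDart (d : D) : Prop := u.leftFace d = u.internal ∧ u.rightFace d = u.external

/-- Replaces the graph-theoretic cycle by a condition on faces, the only form used in the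
enumeration. -/
lemma onCycle_and_rightFace_iff [Finite D] (d : D) :
    u.OnCycle d ∧ u.rightFace d = u.external ↔ u.IsCycleDart d := by
  constructor
  · rintro ⟨h1, h2⟩
    have := u.leftFace_ne_rightFace_of_onCycle h1
    rw [h2, u.not_eq_external_iff] at this
    exact ⟨this, h2⟩
  · rintro ⟨h1, h2⟩
    refine ⟨u.onCycle_of_leftFace_ne_rightFace ?_, h2⟩
    rw [h1, h2]
    exact u.internal_ne_external

/-- The length of the cycle of a unicycle. -/
noncomputable def cycleLength : ℕ := Nat.card {d : D // u.IsCycleDart d}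

end Unicycle

/-! ### Counting the labellings of a given unicycle -/

lemma card_zero_sum_eq (ι : Type*) [Fintype ι] :
    Nat.card {g : ι → Finset.Icc (-1 : ℤ) 1 // ∑ i, (g i : ℤ) = 0} =
      centralTrinomial (Nat.card ι) := by
  classical
  rw [centralTrinomial, ← Fintype.card_subtype, ← Nat.card_eq_fintype_card]
  have e : ι ≃ Fin (Nat.card ι) := Finite.equivFin ι
  refine Nat.card_congr (Equiv.subtypeEquiv (e.arrowCongr (Equiv.refl _)) fun g => ?_)
  simp [Equiv.arrowCongr, Equiv.sum_comp e.symm (fun i => (g i : ℤ))]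

/-- The coordinates outside `p` are free, with three values each. -/
lemma card_partial_zero_sum_eq (ι : Type*) [Fintype ι] (p : ι → Prop) [DecidablePred p] :
    Nat.card {g : ι → Finset.Icc (-1 : ℤ) 1 // ∑ i with p i, (g i : ℤ) = 0} =
      3 ^ (Nat.card ι - Nat.card {i // p i}) * centralTrinomial (Nat.card {i // p i}) := by
  classical
  have h1 : {g : ι → Finset.Icc (-1 : ℤ) 1 // ∑ i with p i, (g i : ℤ) = 0} ≃
      {g : {i // p i} → Finset.Icc (-1 : ℤ) 1 // ∑ i, (g i : ℤ) = 0} ×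
        ({i // ¬p i} → Finset.Icc (-1 : ℤ) 1) :=
    (Equiv.subtypeEquiv (Equiv.piEquivPiSubtypeProd p _)
      (q := fun x => ∑ i, (x.1 i : ℤ) = 0) fun g => by
        rw [Equiv.piEquivPiSubtypeProd_apply]
        simp only
        rw [Finset.sum_subtype (p := p) _ (by simp)]).trans
      (Equiv.prodSubtypeFstEquivSubtypeProd
        (p := fun g : {i // p i} → Finset.Icc (-1 : ℤ) 1 => ∑ i, (g i : ℤ) = 0))
  rw [Nat.card_congr h1, Nat.card_prod, card_zero_sum_eq, mul_comm]
  congr 1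
  rw [Nat.card_fun, Nat.card_eq_fintype_card, Fintype.card_coe,
    Nat.card_eq_fintype_card (α := {i // ¬p i}), Fintype.card_subtype_compl,
    Nat.card_eq_fintype_card, Nat.card_eq_fintype_card]
  rfl

namespace Unicycle

variable {D : Type} (u : Unicycle D)

lemma IsCycleDart.not_rev {u : Unicycle D} {d : D} (h : u.IsCycleDart d) :
    ¬u.IsCycleDart (u.rev d) := by
  intro h'
  exact u.internal_ne_external (h'.1.symm.trans h.2)

/-- A choice of one dart on each edge, which is the cycle dart on the edges of the cycle. -/
lemma exists_orientation : ∃ o : u.Edge → D, (∀ e, u.edge (o e) = e) ∧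
    ∀ d, u.IsCycleDart d → o (u.edge d) = d := by
  classical
  have h : ∀ e : u.Edge, ∃ d, u.edge d = e ∧ ∀ d', u.edge d' = e → u.IsCycleDart d' → d = d' := by
    intro e
    obtain ⟨d, rfl⟩ := u.edge_surjective e
    by_cases hd : u.IsCycleDart (u.rev d)
    · refine ⟨u.rev d, u.edge_rev d, fun d' h1 h2 => ?_⟩
      rcases u.edge_eq_iff.1 h1 with h | h
      · rw [h] at hd; exact absurd hd h2.not_rev
      · rw [h, u.rev_rev]
    · refine ⟨d, rfl, fun d' h1 h2 => ?_⟩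
      rcases u.edge_eq_iff.1 h1 with h | h
      · exact h
      · rw [h, u.rev_rev] at hd; exact absurd h2 hd
  choose o ho1 ho2 using h
  exact ⟨o, ho1, fun d hd => ho2 _ _ rfl hd⟩

lemma card_cycle_edges {o : u.Edge → D} (ho1 : ∀ e, u.edge (o e) = e)
    (ho2 : ∀ d, u.IsCycleDart d → o (u.edge d) = d) :
    Nat.card {e // u.IsCycleDart (o e)} = u.cycleLength :=
  Nat.card_congr
    { toFun := fun e => ⟨o e, e.2⟩
      invFun := fun d => ⟨u.edge d, by rw [ho2 _ d.2]; exact d.2⟩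
      left_inv := fun e => Subtype.ext (ho1 e)
      right_inv := fun d => Subtype.ext (ho2 _ d.2) }

/-- Edge by edge: an edge with the internal face on both sides contributes δ - δ = 0, an edge off
the internal face contributes nothing, and `o` orients the remaining edges with the internal face on
the left. -/
lemma sum_internal [Fintype D] [Fintype u.Edge] [DecidableEq u.Face]
    {o : u.Edge → D} [DecidablePred fun e => u.IsCycleDart (o e)] (ho1 : ∀ e, u.edge (o e) = e)
    (ho2 : ∀ d, u.IsCycleDart d → o (u.edge d) = d) {δ : D → ℚ} (hδ : ∀ d, δ (u.rev d) = -δ d) :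
    ∑ d with u.leftFace d = u.internal, δ d = ∑ e with u.IsCycleDart (o e), δ (o e) := by
  rw [Finset.sum_filter, Finset.sum_filter, u.sum_eq_sum_edge ho1]
  refine Finset.sum_congr rfl fun e _ => ?_
  rw [hδ, u.leftFace_rev]
  by_cases h1 : u.leftFace (o e) = u.internal
  · by_cases h2 : u.rightFace (o e) = u.internal
    · have : ¬u.IsCycleDart (o e) := fun h => u.internal_ne_external (h2.symm.trans h.2)
      simp [h1, h2, this]
    · have : u.IsCycleDart (o e) := ⟨h1, u.not_eq_internal_iff.1 h2⟩
      simp [h1, h2, this]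
  · have h3 : ¬u.IsCycleDart (o e) := fun h => h1 h.1
    by_cases h2 : u.rightFace (o e) = u.internal
    · have h4 : u.IsCycleDart (u.rev (o e)) :=
        ⟨h2, by rw [u.rightFace_rev]; exact u.not_eq_internal_iff.1 h1⟩
      have h5 := ho2 _ h4
      rw [u.edge_rev, ho1] at h5
      exact absurd h5.symm (u.rev_ne _)
    · simp [h1, h2, h3]

/-- The well-labellings of a unicycle which vanish at the origin of the dart `root`. -/
abbrev Labelling (root : D) : Type :=
  {label : u.Vertex → ℤ // (∀ x y, u.Adj x y → |label x - label y| ≤ 1) ∧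
    label (u.origin root) = 0}

/-- Potentials come from linear algebra over ℚ. Once normalized at the root they are integral, since
integrality spreads along edges with integral increments. -/
lemma exists_labelling [Finite D] (root : D) (δ : D → ℤ)
    (f : u.Vertex → ℚ) (hf : ∀ d, u.grad f d = δ d) :
    ∃ l : u.Vertex → ℤ, (∀ d, l (u.target d) - l (u.origin d) = δ d) ∧ l (u.origin root) = 0 := by
  have h : ∀ x, ∃ z : ℤ, f x - f (u.origin root) = z := by
    intro x
    obtain ⟨d, rfl⟩ := u.origin_surjective x
    refine u.induction_on (P := fun d => ∃ z : ℤ, f (u.origin d) - f (u.origin root) = z)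
      root ⟨0, by simp⟩ ?_ ?_ d
    · rintro d ⟨z, hz⟩
      refine ⟨z + δ d, ?_⟩
      have := hf d
      rw [CombMap.grad_apply] at this
      rw [u.origin_rev]
      push_cast
      linarith
    · rintro d ⟨z, hz⟩
      exact ⟨z, by rw [u.origin_rot, hz]⟩
  choose l hl using h
  refine ⟨l, fun d => ?_, ?_⟩
  · have := hf d
    rw [CombMap.grad_apply] at this
    have h1 := hl (u.target d)
    have h2 := hl (u.origin d)
    have : ((l (u.target d) - l (u.origin d) : ℤ) : ℚ) = δ d := by
      push_cast; linarith
    exact_mod_cast this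
  · have := hl (u.origin root)
    rw [sub_self] at this
    exact_mod_cast this.symm

/-- The number of well-labellings of a unicycle only depends on the length of its cycle. -/
lemma card_labelling [Finite D] (root : D) :
    Nat.card (u.Labelling root) =
      3 ^ (Nat.card u.Edge - u.cycleLength) * centralTrinomial u.cycleLength := by
  classical
  have := Fintype.ofFinite D
  have := Fintype.ofFinite u.Edge
  obtain ⟨o, ho1, ho2⟩ := u.exists_orientation
  rw [← u.card_cycle_edges ho1 ho2, ← card_partial_zero_sum_eq]
  have hcases : ∀ d, d = o (u.edge d) ∨ d = u.rev (o (u.edge d)) :=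
    fun d => u.edge_eq_iff.1 (ho1 (u.edge d))
  have hbound : ∀ (l : u.Labelling root) (d : D),
      l.1 (u.target d) - l.1 (u.origin d) ∈ Finset.Icc (-1 : ℤ) 1 := fun l d =>
    Finset.mem_Icc.2 (abs_le.1 (l.2.1 _ _ ⟨u.rev d, rfl, u.target_rev d⟩))
  refine Nat.card_eq_of_bijective (fun l : u.Labelling root =>
    (⟨fun e => ⟨l.1 (u.target (o e)) - l.1 (u.origin (o e)), hbound l _⟩, ?_⟩ :
      {g : u.Edge → Finset.Icc (-1 : ℤ) 1 // ∑ e with u.IsCycleDart (o e), (g e : ℤ) = 0}))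
    ⟨fun l l' h => ?_, fun g => ?_⟩
  -- The increments sum to zero on the cycle because that sum is the circulation of a gradient
  -- around the internal face.
  · have h1 := u.sum_internal ho1 ho2 (u.grad_mem_antisymm fun x => (l.1 x : ℚ))
    rw [u.sum_leftFace_grad] at h1
    have h2 : ((∑ e with u.IsCycleDart (o e),
      (l.1 (u.target (o e)) - l.1 (u.origin (o e))) : ℤ) : ℚ) = 0 := by
      rw [h1]; push_cast; rfl
    exact_mod_cast h2
  · have hdiff : ∀ d, l.1 (u.target d) - l.1 (u.origin d) = l'.1 (u.target d) - l'.1 (u.origin d) := by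
      intro d
      have h1 := congrArg Subtype.val (congrFun (congrArg Subtype.val h) (u.edge d))
      simp only at h1
      rcases hcases d with h2 | h2
      · rw [← h2] at h1; exact h1
      · rw [h2, u.target_rev, u.origin_rev]; linarith
    refine Subtype.ext (funext fun x => ?_)
    have := u.eq_of_forall_target_eq (fun x => l.1 x - l'.1 x)
      (fun d => by have := hdiff d; linarith) x (u.origin root)
    simp only [l.2.2, l'.2.2] at this
    linarith
  -- Conversely, prescribed increments are extended antisymmetrically to all darts; the zero sum is
  -- exactly what makes them a gradient.
  · set δ : D → ℤ := fun d => if o (u.edge d) = d then g.1 (u.edge d) else -g.1 (u.edge d) with hδ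
    have hoo : ∀ e, δ (o e) = g.1 e := fun e => by simp [hδ, ho1]
    have hor : ∀ e, δ (u.rev (o e)) = -g.1 e := fun e => by
      simp [hδ, ho1, (u.rev_ne (o e)).symm]
    have hanti : ∀ d, δ (u.rev d) = -δ d := by
      intro d
      rcases hcases d with h2 | h2
      · rw [h2, hoo, hor]
      · rw [h2, u.rev_rev, hoo, hor, neg_neg]
    obtain ⟨f, hf⟩ := u.exists_grad_eq u.internal (δ := fun d => (δ d : ℚ))
      (fun d => by rw [hanti]; push_cast; rfl) (by
        rw [u.sum_internal ho1 ho2 (fun d => by rw [hanti]; push_cast; rfl)]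
        simp only [hoo]
        exact_mod_cast g.2)
    obtain ⟨l, hl, hl0⟩ := u.exists_labelling root δ f (fun d => by rw [hf])
    refine ⟨⟨l, ?_, hl0⟩, ?_⟩
    · rintro _ _ ⟨d, rfl, rfl⟩
      rw [abs_sub_comm, hl, abs_le, ← Finset.mem_Icc]
      rcases hcases d with h2 | h2
      · rw [h2, hoo]; exact (g.1 _).2
      · rw [h2, hor]
        have := Finset.mem_Icc.1 (g.1 (u.edge d)).2
        rw [Finset.mem_Icc]
        omega
    · refine Subtype.ext (funext fun e => Subtype.ext ?_)
      exact (hl (o e)).trans (hoo e)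

end Unicycle

/-! ### Renaming of darts, and rigidity of rooted maps -/

namespace CombMap

variable {D : Type} (m : CombMap D)

/-- Renaming of the darts of a map. -/
def relabel (e : Equiv.Perm D) : CombMap D where
  rev := e * m.rev * e⁻¹
  rot := e * m.rot * e⁻¹
  rev_rev d := by simp [m.rev_rev]
  rev_ne d h := m.rev_ne (e⁻¹ d) (by
    simpa using congrArg (e⁻¹ : Equiv.Perm D) h)
  connected d d' := by
    obtain ⟨g, hg, h⟩ := m.connected (e⁻¹ d) (e⁻¹ d')
    refine ⟨e * g * e⁻¹, ?_, (congrArg e h).trans (e.apply_symm_apply d')⟩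
    have := Subgroup.mem_map_of_mem (MulAut.conj e).toMonoidHom hg
    rw [MonoidHom.map_closure, Set.image_pair] at this
    exact this

lemma faceNext_relabel (e : Equiv.Perm D) : (m.relabel e).faceNext = e * m.faceNext * e⁻¹ := by
  simp only [faceNext, relabel]
  group

def relabelVertex (e : Equiv.Perm D) : (m.relabel e).Vertex ≃ m.Vertex :=
  Quotient.congr (e⁻¹ : Equiv.Perm D) fun _ _ => Equiv.Perm.sameCycle_conj

def relabelEdge (e : Equiv.Perm D) : (m.relabel e).Edge ≃ m.Edge :=
  Quotient.congr (e⁻¹ : Equiv.Perm D) fun _ _ => Equiv.Perm.sameCycle_conj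

def relabelFace (e : Equiv.Perm D) : (m.relabel e).Face ≃ m.Face :=
  Quotient.congr (e⁻¹ : Equiv.Perm D) fun a b => by
    change (m.relabel e).faceNext.SameCycle a b ↔ _
    rw [faceNext_relabel]
    exact Equiv.Perm.sameCycle_conj

@[simp] lemma relabel_rev (e : Equiv.Perm D) (d : D) : (m.relabel e).rev (e d) = e (m.rev d) := by
  simp [relabel]

@[simp] lemma relabel_rot (e : Equiv.Perm D) (d : D) : (m.relabel e).rot (e d) = e (m.rot d) := by
  simp [relabel]

@[simp] lemma relabelVertex_origin (e : Equiv.Perm D) (d : D) :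
    m.relabelVertex e ((m.relabel e).origin (e d)) = m.origin d := by
  change Quotient.mk _ (e⁻¹ (e d)) = Quotient.mk _ d
  simp

@[simp] lemma relabelFace_leftFace (e : Equiv.Perm D) (d : D) :
    m.relabelFace e ((m.relabel e).leftFace (e d)) = m.leftFace d := by
  change Quotient.mk _ (e⁻¹ (e d)) = Quotient.mk _ d
  simp

lemma adj_relabelVertex {e : Equiv.Perm D} {x y : (m.relabel e).Vertex} (h : (m.relabel e).Adj x y) :
    m.Adj (m.relabelVertex e x) (m.relabelVertex e y) := by
  obtain ⟨d, rfl, rfl⟩ := h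
  obtain ⟨d, rfl⟩ := e.surjective d
  exact ⟨d, by simp, by
    rw [target, target, relabel_rev, relabelVertex_origin]⟩

end CombMap

namespace Unicycle

variable {D : Type}

/-- Renaming of the darts of a unicycle. -/
def relabel (u : Unicycle D) (e : Equiv.Perm D) : Unicycle D where
  toCombMap := u.toCombMap.relabel e
  planar := by
    rw [CombMap.IsPlanar, Nat.card_congr (u.relabelVertex e), Nat.card_congr (u.relabelFace e),
      Nat.card_congr (u.relabelEdge e)]
    exact u.planar
  internal := (u.relabelFace e).symm u.internal
  external := (u.relabelFace e).symm u.external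
  internal_ne_external h := u.internal_ne_external ((u.relabelFace e).symm.injective h)
  eq_or_eq f := by
    rw [Equiv.eq_symm_apply, Equiv.eq_symm_apply]
    exact u.eq_or_eq _

lemma relabel_leftFace_eq_internal (u : Unicycle D) (e : Equiv.Perm D) (d : D) :
    (u.relabel e).leftFace (e d) = (u.relabel e).internal ↔ u.leftFace d = u.internal := by
  change (u.toCombMap.relabel e).leftFace (e d) = (u.relabelFace e).symm u.internal ↔ _
  rw [Equiv.eq_symm_apply, CombMap.relabelFace_leftFace]

lemma relabel_leftFace_eq_external (u : Unicycle D) (e : Equiv.Perm D) (d : D) :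
    (u.relabel e).leftFace (e d) = (u.relabel e).external ↔ u.leftFace d = u.external := by
  change (u.toCombMap.relabel e).leftFace (e d) = (u.relabelFace e).symm u.external ↔ _
  rw [Equiv.eq_symm_apply, CombMap.relabelFace_leftFace]

lemma relabel_isCycleDart (u : Unicycle D) (e : Equiv.Perm D) (d : D) :
    (u.relabel e).IsCycleDart (e d) ↔ u.IsCycleDart d := by
  rw [IsCycleDart, IsCycleDart, relabel_leftFace_eq_internal, CombMap.rightFace, CombMap.rightFace,
    ← relabel_leftFace_eq_external u e]
  congr! 3
  exact u.relabel_rev e d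

/-- A unicycle is determined by its permutations of the darts and by the darts on its faces. -/
lemma ext_of_darts {u v : Unicycle D} (hrev : u.rev = v.rev) (hrot : u.rot = v.rot)
    (hint : ∀ d, u.leftFace d = u.internal ↔ v.leftFace d = v.internal)
    (hext : ∀ d, u.leftFace d = u.external ↔ v.leftFace d = v.external) : u = v := by
  obtain ⟨⟨rev, rot, _, _, _⟩, _, i, x, _, _⟩ := u
  obtain ⟨⟨rev', rot', _, _, _⟩, _, i', x', _, _⟩ := v
  obtain rfl : rev = rev' := hrev
  obtain rfl : rot = rot' := hrot
  obtain rfl : i = i' := by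
    obtain ⟨d, rfl⟩ := Quotient.mk_surjective i
    exact (hint d).1 rfl
  obtain rfl : x = x' := by
    obtain ⟨d, rfl⟩ := Quotient.mk_surjective x
    exact (hext d).1 rfl
  rfl

instance [Finite D] : Finite (Unicycle D) := by
  refine Finite.of_injective (β := Equiv.Perm D × Equiv.Perm D × Set D × Set D)
    (fun u => (u.rev, u.rot, {d | u.leftFace d = u.internal}, {d | u.leftFace d = u.external}))
    fun u v h => ?_
  simp only [Prod.mk.injEq, Set.ext_iff, Set.mem_ofPred_eq] at h
  exact ext_of_darts h.1 h.2.1 h.2.2.1 h.2.2.2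

/-- Rigidity: two renamings with the same result agree on a set of darts stable under `rev` and
`rot`, hence everywhere once they agree at `d₀`. -/
lemma eq_of_relabel_eq [Finite D] {u : Unicycle D} {e e' : Equiv.Perm D} (h : u.relabel e = u.relabel e')
    {d₀ : D} (h0 : e d₀ = e' d₀) : e = e' := by
  have hrev : e * u.rev * e⁻¹ = e' * u.rev * e'⁻¹ := congrArg (fun v : Unicycle D => v.rev) h
  have hrot : e * u.rot * e⁻¹ = e' * u.rot * e'⁻¹ := congrArg (fun v : Unicycle D => v.rot) h
  have hcomm : ∀ f : Equiv.Perm D, e * f * e⁻¹ = e' * f * e'⁻¹ →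
      ∀ d, e d = e' d → e (f d) = e' (f d) := by
    intro f hf d hd
    have h1 : e (f (e⁻¹ (e d))) = e' (f (e'⁻¹ (e d))) := Equiv.congr_fun hf (e d)
    have h2 : e⁻¹ (e d) = d := e.symm_apply_apply d
    have h3 : e'⁻¹ (e d) = d := by rw [hd]; exact e'.symm_apply_apply d
    rwa [h2, h3] at h1
  refine Equiv.ext fun d => u.induction_on (P := fun d => e d = e' d) d₀ h0 ?_ ?_ d
  · exact hcomm _ hrev
  · exact hcomm _ hrot

end Unicycle

namespace RootedUnicycle

variable {D : Type}

/-- Renaming of the darts of a rooted well-labelled unicycle. -/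
def relabel (u : RootedUnicycle D) (e : Equiv.Perm D) : RootedUnicycle D where
  toUnicycle := u.toUnicycle.relabel e
  label x := u.label (u.relabelVertex e x)
  wellLabelled x y h := u.wellLabelled _ _ (u.adj_relabelVertex h)
  root := e u.root
  label_root := by
    rw [← u.label_root]
    exact congrArg u.label (u.relabelVertex_origin e u.root)

/-- Isomorphism classes are thus the orbits under renaming, and by rigidity these orbits are free.
-/
lemma iso_iff {u v : RootedUnicycle D} : Iso u v ↔ ∃ e, u.relabel e = v := by
  constructor
  · rintro ⟨e, h1, h2, h3, h4, h5, h6⟩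
    refine ⟨e, ?_⟩
    have huv : u.toUnicycle.relabel e = v.toUnicycle := by
      refine Unicycle.ext_of_darts (Equiv.ext fun d => ?_) (Equiv.ext fun d => ?_) (fun d => ?_)
        (fun d => ?_)
      · obtain ⟨d, rfl⟩ := e.surjective d
        exact (u.relabel_rev e d).trans (h1 d)
      · obtain ⟨d, rfl⟩ := e.surjective d
        exact (u.relabel_rot e d).trans (h2 d)
      · obtain ⟨d, rfl⟩ := e.surjective d
        rw [Unicycle.relabel_leftFace_eq_internal, h3]
      · obtain ⟨d, rfl⟩ := e.surjective d
        rw [Unicycle.relabel_leftFace_eq_external, h4]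
    have hlab : ∀ d, (u.relabel e).label ((u.relabel e).origin (e d)) = v.label (v.origin (e d)) :=
      fun d => (congrArg u.label (u.relabelVertex_origin e d)).trans (h5 d)
    have hroot : (u.relabel e).root = v.root := h6
    change (u.relabel e).toUnicycle = v.toUnicycle at huv
    generalize u.relabel e = w at *
    obtain ⟨w, l, _, r, _⟩ := w
    obtain ⟨v, l', _, r', _⟩ := v
    obtain rfl : w = v := huv
    obtain rfl : r = r' := hroot
    obtain rfl : l = l' := by
      funext x
      obtain ⟨d, rfl⟩ := w.origin_surjective x
      obtain ⟨d, rfl⟩ := e.surjective d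
      exact hlab d
    rfl
  · rintro ⟨e, rfl⟩
    exact ⟨e, fun d => (u.relabel_rev e d).symm, fun d => (u.relabel_rot e d).symm,
      fun d => (u.relabel_leftFace_eq_internal e d).symm,
      fun d => (u.relabel_leftFace_eq_external e d).symm,
      fun d => (congrArg u.label (u.relabelVertex_origin e d)).symm, rfl⟩

lemma eq_of_relabel_eq [Finite D] {u : RootedUnicycle D} {e e' : Equiv.Perm D}
    (h : u.relabel e = u.relabel e') : e = e' :=
  Unicycle.eq_of_relabel_eq (congrArg RootedUnicycle.toUnicycle h)
    (congrArg RootedUnicycle.root h)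

lemma rootOnCycle_iff [Finite D] (u : RootedUnicycle D) :
    u.RootOnCycle ↔ u.IsCycleDart u.root :=
  u.onCycle_and_rightFace_iff u.root

lemma relabel_rootOnCycle_iff [Finite D] (u : RootedUnicycle D) (e : Equiv.Perm D) :
    (u.relabel e).RootOnCycle ↔ u.RootOnCycle := by
  rw [rootOnCycle_iff, rootOnCycle_iff]
  exact u.relabel_isCycleDart e u.root

end RootedUnicycle

/-- If the classes of an equivalence relation are the orbits of a free family of maps, then all the
classes have the same number of elements. -/
lemma card_eq_card_mul_card_quotient {A G : Type*} (s : Setoid A) (f : A → G → A)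
    (h1 : ∀ a b, s a b ↔ ∃ g, f a g = b) (h2 : ∀ a g g', f a g = f a g' → g = g') :
    Nat.card A = Nat.card G * Nat.card (Quotient s) := by
  rw [mul_comm, ← Nat.card_prod]
  refine (Nat.card_eq_of_bijective (fun p : Quotient s × G => f p.1.out p.2) ⟨?_, ?_⟩).symm
  · rintro ⟨q, g⟩ ⟨q', g'⟩ h
    simp only at h
    have hq : q = q' := by
      rw [← Quotient.out_equiv_out]
      have ha := (h1 q.out _).2 ⟨g, rfl⟩
      rw [h] at ha
      exact s.trans ha (s.symm ((h1 q'.out _).2 ⟨g', rfl⟩))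
    subst hq
    rw [h2 _ _ _ h]
  · intro a
    obtain ⟨g, hg⟩ := (h1 (Quotient.mk s a).out a).1 (Quotient.mk_out a)
    exact ⟨(Quotient.mk s a, g), hg⟩

lemma card_rootedUnicycle_eq (n : ℕ) : Nat.card (RootedUnicycle (Fin (2 * n))) =
    (2 * n).factorial * Nat.card (WellLabelledUnicycles n) := by
  rw [card_eq_card_mul_card_quotient (RootedUnicycle.isoSetoid (Fin (2 * n)))
    RootedUnicycle.relabel (fun _ _ => RootedUnicycle.iso_iff)
    (fun _ _ _ => RootedUnicycle.eq_of_relabel_eq), Nat.card_perm, Nat.card_eq_fintype_card,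
    Fintype.card_fin]
  rfl

lemma card_rootOnCycle_eq (n : ℕ) :
    Nat.card {u : RootedUnicycle (Fin (2 * n)) // u.RootOnCycle} =
      (2 * n).factorial * Nat.card (CyclePointedUnicycles n) := by
  rw [card_eq_card_mul_card_quotient ((RootedUnicycle.isoSetoid (Fin (2 * n))).comap
    (Subtype.val : {u : RootedUnicycle (Fin (2 * n)) // u.RootOnCycle} → _))
    (fun u e => ⟨u.1.relabel e, (u.1.relabel_rootOnCycle_iff e).2 u.2⟩)
    (fun u v => ?_)
    (fun _ _ _ h => RootedUnicycle.eq_of_relabel_eq (congrArg Subtype.val h)), Nat.card_perm,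
    Nat.card_eq_fintype_card, Fintype.card_fin]
  · rfl
  · simp only [Subtype.ext_iff]
    exact RootedUnicycle.iso_iff

/-! ### Rooted objects as sums over unicycles with named darts -/

namespace Unicycle

variable {D : Type}

lemma centralTrinomial_pos (k : ℕ) : 0 < centralTrinomial k :=
  Finset.card_pos.2 ⟨fun _ => ⟨0, by simp⟩, by simp⟩

instance [Finite D] (u : Unicycle D) (root : D) : Finite (u.Labelling root) := by
  -- `Nat.card` is 0 on infinite types, so the nonzero count already obtained proves finiteness.
  refine Nat.finite_of_card_ne_zero ?_
  rw [card_labelling]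
  exact (Nat.mul_pos (by positivity) (centralTrinomial_pos _)).ne'

/-- A rooted well-labelled unicycle is a unicycle with a root and a well-labelling. -/
def rootedEquiv (D : Type) :
    RootedUnicycle D ≃ (u : Unicycle D) × (root : D) × u.Labelling root where
  toFun u := ⟨u.toUnicycle, u.root, u.label, u.wellLabelled, u.label_root⟩
  invFun u := ⟨u.1, u.2.2.1, u.2.2.2.1, u.2.1, u.2.2.2.2⟩
  left_inv _ := rfl
  right_inv _ := rfl

lemma card_rootedUnicycle [Finite D] [Fintype (Unicycle D)] :
    Nat.card (RootedUnicycle D) = ∑ u : Unicycle D, Nat.card D *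
      (3 ^ (Nat.card D / 2 - u.cycleLength) * centralTrinomial u.cycleLength) := by
  have := Fintype.ofFinite D
  rw [Nat.card_congr (rootedEquiv D), Nat.card_sigma]
  refine Finset.sum_congr rfl fun u _ => ?_
  rw [Nat.card_sigma]
  simp only [card_labelling, Finset.sum_const, Finset.card_univ, smul_eq_mul, ← u.two_mul_card_edge]
  rw [Nat.mul_div_cancel_left _ two_pos, ← Nat.card_eq_fintype_card, ← u.two_mul_card_edge]

lemma card_rootOnCycle [Finite D] [Fintype (Unicycle D)] :
    Nat.card {u : RootedUnicycle D // u.RootOnCycle} = ∑ u : Unicycle D, u.cycleLength *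
      (3 ^ (Nat.card D / 2 - u.cycleLength) * centralTrinomial u.cycleLength) := by
  classical
  have := Fintype.ofFinite D
  have e : {u : RootedUnicycle D // u.RootOnCycle} ≃
      (u : Unicycle D) × (root : {d // u.IsCycleDart d}) × u.Labelling root :=
    { toFun := fun u => ⟨u.1.toUnicycle, ⟨u.1.root, (u.1.rootOnCycle_iff).1 u.2⟩, u.1.label,
        u.1.wellLabelled, u.1.label_root⟩
      invFun := fun u => ⟨⟨u.1, u.2.2.1, u.2.2.2.1, u.2.1, u.2.2.2.2⟩,
        (RootedUnicycle.rootOnCycle_iff _).2 u.2.1.2⟩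
      left_inv := fun _ => rfl
      right_inv := fun _ => rfl }
  rw [Nat.card_congr e, Nat.card_sigma]
  refine Finset.sum_congr rfl fun u _ => ?_
  rw [Nat.card_sigma]
  simp only [card_labelling, Finset.sum_const, Finset.card_univ, smul_eq_mul, ← u.two_mul_card_edge]
  rw [Nat.mul_div_cancel_left _ two_pos, ← Nat.card_eq_fintype_card]
  rfl

end Unicycle

/-! ### First-passage numbers -/

/-- The number of walks with steps `±1` and length `N` which reach the height `j` for the first time
at time `N`. -/
def firstPassage : ℕ → ℕ → ℕ
  | 0, 0 => 1
  | 0, _ + 1 => 0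
  | _ + 1, 0 => 0
  | N + 1, j + 1 => firstPassage N j + firstPassage N (j + 2)

/-- A walk to height k + l is cut at its first visit to k; formally this is an induction on the
recursion for the first step. -/
lemma sum_firstPassage_mul (N k l : ℕ) :
    ∑ p ∈ Finset.HasAntidiagonal.antidiagonal N, firstPassage p.1 k * firstPassage p.2 l =
      firstPassage N (k + l) := by
  induction N generalizing k with
  | zero =>
    cases k <;> cases l <;> simp [firstPassage]
  | succ N ih =>
    rw [Finset.Nat.sum_antidiagonal_succ]
    cases k with
    | zero => simp [firstPassage]
    | succ k =>
      simp only [firstPassage, add_mul, Finset.sum_add_distrib, ih]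
      rw [show k + 1 + l = (k + l) + 1 by ring, firstPassage, show k + 2 + l = k + l + 2 by ring]
      simp

/-- The ballot theorem, with b the number of steps away from the target. The first-step recursion is
matched with Pascal's rule. -/
lemma mul_firstPassage (b j : ℕ) :
    (2 * b + j) * firstPassage (2 * b + j) j = j * (2 * b + j).choose b := by
  obtain ⟨N, hN⟩ : ∃ N, N = 2 * b + j := ⟨_, rfl⟩
  induction N generalizing b j with
  | zero =>
    obtain rfl : b = 0 := by omega
    obtain rfl : j = 0 := by omega
    simp
  | succ N ih =>
    cases j with
    | zero =>
      rw [← hN, firstPassage]; simp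
    | succ j =>
      rw [show 2 * b + (j + 1) = (2 * b + j) + 1 by ring, firstPassage]
      have h1 := ih b j (by omega)
      cases b with
      | zero =>
        rcases Nat.eq_zero_or_pos j with rfl | hj
        · simp [firstPassage]
        · have h3 : ∀ M i, M < i → firstPassage M i = 0 := by
            intro M
            induction M with
            | zero => intro i hi; cases i <;> simp_all [firstPassage]
            | succ M ihM =>
              intro i hi
              cases i with
              | zero => omega
              | succ i => rw [firstPassage, ihM _ (by omega), ihM _ (by omega)]
          simp only [mul_zero, zero_add, Nat.choose_zero_right, mul_one] at h1 ⊢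
          rw [h3 j (j + 2) (by omega)]
          have : firstPassage j j = 1 := Nat.eq_of_mul_eq_mul_left hj (by simpa using h1)
          rw [this]; simp
      | succ b =>
        have h2 := ih b (j + 2) (by omega)
        rw [show 2 * b + (j + 2) = 2 * (b + 1) + j by ring] at h2
        set M := 2 * (b + 1) + j with hM
        have hM0 : (M : ℚ) ≠ 0 := by positivity
        have h4 := Nat.choose_succ_right_eq M b
        rw [show M - b = b + j + 2 by omega] at h4
        have h5 := Nat.add_one_mul_choose_eq M (b + 1)
        have h6 := Nat.choose_succ_succ M b
        have hMq : (M : ℚ) = 2 * (b + 1) + j := by rw [hM]; push_cast; ring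
        have h1' : (M : ℚ) * firstPassage M j = j * M.choose (b + 1) := by exact_mod_cast h1
        have h2' : (M : ℚ) * firstPassage M (j + 2) = (j + 2) * M.choose b := by exact_mod_cast h2
        have h4' : (M.choose (b + 1) : ℚ) * (b + 1) = M.choose b * (b + j + 2) := by
          exact_mod_cast h4
        have h6' : ((M + 1).choose (b + 1) : ℚ) = M.choose b + M.choose (b + 1) := by
          exact_mod_cast h6
        have : ((M + 1 : ℕ) * (firstPassage M j + firstPassage M (j + 2) : ℕ) : ℚ) =
            (j + 1 : ℕ) * (M + 1).choose (b + 1) := by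
          -- Both induction hypotheses carry the factor M, hence the multiplication by M.
          apply mul_left_cancel₀ hM0
          push_cast
          rw [h6']
          have e : (M : ℚ) * ((M + 1) * (firstPassage M j + firstPassage M (j + 2))) =
              (M + 1) * (j * M.choose (b + 1) + (j + 2) * M.choose b) := by
            rw [← h1', ← h2']; ring
          rw [e, hMq]
          linear_combination (-2 : ℚ) * h4'
        exact_mod_cast this

lemma mul_firstPassage_two_mul {n k : ℕ} (h : k ≤ n) :
    n * firstPassage (2 * n) (2 * k) = k * (2 * n).choose (n + k) := by
  have := mul_firstPassage (n - k) (2 * k)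
  rw [show 2 * (n - k) + 2 * k = 2 * n by omega, mul_assoc, mul_assoc] at this
  have h1 := Nat.eq_of_mul_eq_mul_left two_pos this
  rw [h1, ← Nat.choose_symm_of_eq_add (show 2 * n = (n + k) + (n - k) by omega)]

/-! ### Walks encoded by words -/

/-- The sign of a letter. -/
def letter (b : Bool) : ℤ := if b then 1 else -1

@[simp] lemma letter_true : letter true = 1 := rfl
@[simp] lemma letter_false : letter false = -1 := rfl

/-- The sum of the values of a function at the first `i` elements of `Fin M`. -/
def partialSum {M : ℕ} {R : Type*} [AddCommMonoid R] (δ : Fin M → R) (i : ℕ) : R :=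
  ∑ j ∈ Finset.range i, if h : j < M then δ ⟨j, h⟩ else 0

section

variable {M : ℕ} {R : Type*} [AddCommMonoid R] (δ : Fin M → R)

@[simp] lemma partialSum_zero : partialSum δ 0 = 0 := rfl

lemma partialSum_succ (i : Fin M) : partialSum δ (i + 1) = partialSum δ i + δ i := by
  rw [partialSum, Finset.sum_range_succ, dif_pos i.2]; rfl

lemma partialSum_eq_sum {i : ℕ} (hi : i ≤ M) :
    partialSum δ i = ∑ p : Fin M with p.val < i, δ p := by
  have h1 := Fin.sum_univ_eq_sum_range
    (fun j => if j < i then (if h : j < M then δ ⟨j, h⟩ else 0) else 0) M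
  rw [← Finset.sum_filter, ← Finset.sum_filter] at h1
  have h2 : (Finset.range M).filter (· < i) = Finset.range i := by
    ext j; simp; omega
  rw [h2] at h1
  rw [partialSum, ← h1]
  exact Finset.sum_congr rfl fun p _ => by rw [dif_pos p.2]

lemma partialSum_eq_add {a l : ℕ} (hal : a ≤ l) (hl : l ≤ M) :
    partialSum δ l = ∑ p : Fin M with a ≤ p.val ∧ p.val < l, δ p + partialSum δ a := by
  rw [partialSum_eq_sum _ hl, partialSum_eq_sum _ (hal.trans hl),
    ← Finset.sum_filter_not_add_sum_filter _ (fun p : Fin M => p.val < a), Finset.filter_filter,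
    Finset.filter_filter]
  congr 2
  · ext p; simp; omega
  · ext p; simp; omega

end

/-- The height after `i` steps of the walk which is encoded by a word. -/
def height {M : ℕ} (w : Fin M → Bool) (i : ℕ) : ℤ := partialSum (fun j => letter (w j)) i

lemma height_eq_sum_range {M : ℕ} (w : Fin M → Bool) (i : ℕ) :
    height w i = ∑ j ∈ Finset.range i, if h : j < M then letter (w ⟨j, h⟩) else 0 := rfl

@[simp] lemma height_zero {M : ℕ} (w : Fin M → Bool) : height w 0 = 0 := rfl

lemma height_succ {M : ℕ} (w : Fin M → Bool) (i : Fin M) :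
    height w (i + 1) = height w i + letter (w i) :=
  partialSum_succ _ i

lemma height_snoc {M : ℕ} (w : Fin M → Bool) (b : Bool) {i : ℕ} (hi : i ≤ M) :
    height (Fin.snoc w b : Fin (M + 1) → Bool) i = height w i := by
  rw [height_eq_sum_range, height_eq_sum_range]
  refine Finset.sum_congr rfl fun j hj => ?_
  have hj := Finset.mem_range.1 hj
  rw [dif_pos (by omega), dif_pos (by omega)]
  congr 1
  exact Fin.snoc_castSucc (α := fun _ => Bool) b w ⟨j, by omega⟩

lemma height_snoc_last {M : ℕ} (w : Fin M → Bool) (b : Bool) :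
    height (Fin.snoc w b : Fin (M + 1) → Bool) (M + 1) = height w M + letter b := by
  have := height_succ (Fin.snoc w b : Fin (M + 1) → Bool) (Fin.last M)
  rwa [Fin.val_last, height_snoc _ _ le_rfl, Fin.snoc_last] at this

lemma height_cons {M : ℕ} (w : Fin M → Bool) (b : Bool) (i : ℕ) :
    height (Fin.cons b w : Fin (M + 1) → Bool) (i + 1) = letter b + height w i := by
  rw [height_eq_sum_range, Finset.sum_range_succ', add_comm, height_eq_sum_range, dif_pos (by omega)]
  congr 1
  refine Finset.sum_congr rfl fun j _ => ?_
  by_cases h : j < M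
  · rw [dif_pos (by omega), dif_pos h]; rfl
  · rw [dif_neg (by omega), dif_neg h]

lemma height_append_left {s t : ℕ} (v : Fin t → Bool) (w : Fin s → Bool) {i : ℕ} (hi : i ≤ t) :
    height (Fin.append v w) i = height v i := by
  rw [height_eq_sum_range, height_eq_sum_range]
  refine Finset.sum_congr rfl fun j hj => ?_
  have hj := Finset.mem_range.1 hj
  rw [dif_pos (by omega), dif_pos (by omega)]
  congr 1
  exact Fin.append_left v w ⟨j, by omega⟩

lemma height_append_right {s t : ℕ} (v : Fin t → Bool) (w : Fin s → Bool) (i : ℕ) :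
    height (Fin.append v w) (t + i) = height v t + height w i := by
  rw [height_eq_sum_range, Finset.sum_range_add, ← height_eq_sum_range, height_append_left _ _ le_rfl]
  congr 1
  refine Finset.sum_congr rfl fun j _ => ?_
  by_cases h : j < s
  · rw [dif_pos (by omega), dif_pos h]
    congr 1
    exact Fin.append_right v w ⟨j, h⟩
  · rw [dif_neg (by omega), dif_neg h]

lemma card_bool_prod {X : Type*} [Finite X] (P : Bool × X → Prop) :
    Nat.card {p // P p} = Nat.card {x // P (true, x)} + Nat.card {x // P (false, x)} := by
  rw [Nat.card_congr (Equiv.subtypeProdEquivSigmaSubtype fun a b => P (a, b)), Nat.card_sigma,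
    Fintype.sum_bool]

lemma card_eq_zero_of_forall_not {X : Type*} {P : X → Prop} (h : ∀ x, ¬P x) :
    Nat.card {x // P x} = 0 :=
  have : IsEmpty {x // P x} := ⟨fun x => h _ x.2⟩
  Nat.card_of_isEmpty

/-- Words of walks which stay positive after the start. -/
lemma card_prefix (t k : ℕ) :
    Nat.card {w : Fin t → Bool // (∀ i, 0 < i → i ≤ t → 0 < height w i) ∧ height w t = k} =
      firstPassage t k := by
  induction t generalizing k with
  | zero =>
    cases k with
    | zero =>
      rw [firstPassage, Nat.card_eq_one_iff_unique]
      exact ⟨⟨fun _ _ => Subtype.ext (Subsingleton.elim _ _)⟩,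
        ⟨fun i => i.elim0, fun i h h' => by omega, by simp⟩⟩
    | succ k =>
      rw [firstPassage]
      refine card_eq_zero_of_forall_not fun w h => ?_
      have := h.2
      simp only [height_zero] at this
      omega
  | succ t ih =>
    cases k with
    | zero =>
      rw [firstPassage]
      refine card_eq_zero_of_forall_not fun w h => ?_
      have h1 := h.1 (t + 1) (by omega) le_rfl
      rw [h.2] at h1
      simp at h1
    | succ k =>
      -- Removing the last letter, a step up from k or down from k + 2, realizes the recursion. In
      -- effect these walks are first passages reversed in time.
      have key : ∀ (b : Bool) (l : ℕ) (w : Fin t → Bool), (l : ℤ) + letter b = (k + 1 : ℕ) →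
          (((∀ i, 0 < i → i ≤ t + 1 → 0 < height (Fin.snoc w b : Fin (t + 1) → Bool) i) ∧
            height (Fin.snoc w b : Fin (t + 1) → Bool) (t + 1) = (k + 1 : ℕ)) ↔
          ((∀ i, 0 < i → i ≤ t → 0 < height w i) ∧ height w t = l)) := by
        intro b l w hl
        rw [height_snoc_last]
        constructor
        · rintro ⟨h1, h2⟩
          refine ⟨fun i hi hi' => ?_, by omega⟩
          rw [← height_snoc w b hi']
          exact h1 i hi (by omega)
        · rintro ⟨h1, h2⟩
          refine ⟨fun i hi hi' => ?_, by omega⟩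
          rcases hi'.lt_or_eq with h | rfl
          · rw [height_snoc w b (by omega)]
            exact h1 i hi (by omega)
          · rw [height_snoc_last]; omega
      rw [firstPassage, ← ih, ← ih, Nat.card_congr (Equiv.subtypeEquivOfSubtype
        (Fin.snocEquiv (fun _ : Fin (t + 1) => Bool))).symm, card_bool_prod]
      congr 1
      · exact Nat.card_congr (Equiv.subtypeEquivRight fun w => key true k w (by simp))
      · exact Nat.card_congr (Equiv.subtypeEquivRight fun w => key false (k + 2) w
          (by simp; ring))

/-- Words of walks which reach `0` for the first time at the end. -/
lemma card_suffix (s k : ℕ) :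
    Nat.card {w : Fin s → Bool // (∀ i, i < s → 0 < k + height w i) ∧ k + height w s = 0} =
      firstPassage s k := by
  induction s generalizing k with
  | zero =>
    cases k with
    | zero =>
      rw [firstPassage, Nat.card_eq_one_iff_unique]
      exact ⟨⟨fun _ _ => Subtype.ext (Subsingleton.elim _ _)⟩,
        ⟨fun i => i.elim0, fun i h => by omega, by simp⟩⟩
    | succ k =>
      rw [firstPassage]
      refine card_eq_zero_of_forall_not fun w h => ?_
      have := h.2
      simp only [height_zero] at this
      omega
  | succ s ih =>
    cases k with
    | zero =>
      rw [firstPassage]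
      refine card_eq_zero_of_forall_not fun w h => ?_
      have h1 := h.1 0 (by omega)
      simp at h1
    | succ k =>
      -- Here it is the first letter that is removed.
      have key : ∀ (b : Bool) (l : ℕ) (w : Fin s → Bool), (l : ℤ) = (k + 1 : ℕ) + letter b →
          (((∀ i, i < s + 1 → 0 < (k + 1 : ℕ) + height (Fin.cons b w : Fin (s + 1) → Bool) i) ∧
            (k + 1 : ℕ) + height (Fin.cons b w : Fin (s + 1) → Bool) (s + 1) = 0) ↔
          ((∀ i, i < s → 0 < l + height w i) ∧ l + height w s = 0)) := by
        intro b l w hl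
        rw [height_cons, hl, ← add_assoc]
        refine and_congr_left fun _ => ⟨fun h i hi => ?_, fun h i hi => ?_⟩
        · have := h (i + 1) (by omega)
          rwa [height_cons, ← add_assoc] at this
        · cases i with
          | zero => rw [height_zero]; omega
          | succ i => rw [height_cons, ← add_assoc]; exact h i (by omega)
      rw [firstPassage, add_comm (firstPassage s k), ← ih, ← ih, Nat.card_congr (Equiv.subtypeEquivOfSubtype
        (Fin.consEquiv (fun _ : Fin (s + 1) => Bool))).symm, card_bool_prod]
      congr 1
      · exact Nat.card_congr (Equiv.subtypeEquivRight fun w => key true (k + 2) w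
          (by simp; ring))
      · exact Nat.card_congr (Equiv.subtypeEquivRight fun w => key false k w (by simp))

/-- Words of closed walks which are positive except at both ends. -/
def IsArch {M : ℕ} (w : Fin M → Bool) : Prop :=
  (∀ i, 0 < i → i < M → 0 < height w i) ∧ height w M = 0

/-- The walk is cut at time t. Positivity of k makes the two halves independent: the junction itself
is then above 0. -/
lemma card_isArch {M t s k : ℕ} (hM : M = t + s) (hk : 0 < k) :
    Nat.card {w : Fin M → Bool // IsArch w ∧ height w t = k} =
      firstPassage t k * firstPassage s k := by
  subst hM
  rw [← card_prefix, ← card_suffix, ← Nat.card_prod]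
  refine Nat.card_congr ((Equiv.subtypeEquiv (Fin.appendEquiv t s).symm
    (q := fun p : (Fin t → Bool) × (Fin s → Bool) =>
      ((∀ i, 0 < i → i ≤ t → 0 < height p.1 i) ∧ height p.1 t = k) ∧
      ((∀ i, i < s → 0 < k + height p.2 i) ∧ k + height p.2 s = 0)) fun w => ?_).trans
    (Equiv.subtypeProdEquivProd
      (p := fun v : Fin t → Bool => (∀ i, 0 < i → i ≤ t → 0 < height v i) ∧ height v t = k)
      (q := fun w : Fin s → Bool => (∀ i, i < s → 0 < k + height w i) ∧ k + height w s = 0)))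
  obtain ⟨⟨v, w⟩, rfl⟩ := (Fin.appendEquiv t s).surjective w
  rw [Equiv.symm_apply_apply]
  change (IsArch (Fin.append v w) ∧ height (Fin.append v w) t = k) ↔ _
  rw [IsArch, height_append_left _ _ le_rfl, height_append_right]
  constructor
  · rintro ⟨⟨h1, h2⟩, h3⟩
    refine ⟨⟨fun i hi hi' => ?_, h3⟩, fun i hi => ?_, by rw [← h3]; exact h2⟩
    · rcases hi'.lt_or_eq with h | rfl
      · rw [← height_append_left v w hi']
        exact h1 i hi (by omega)
      · rw [h3]; exact_mod_cast hk
    · rw [← h3, ← height_append_right]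
      rcases Nat.eq_zero_or_pos (t + i) with h | h
      · obtain rfl : t = 0 := by omega
        simp only [height_zero] at h3
        omega
      · exact h1 _ h (by omega)
  · rintro ⟨⟨h1, h2⟩, h3, h4⟩
    refine ⟨⟨fun i hi hi' => ?_, by rw [h2]; exact h4⟩, h2⟩
    rcases le_total i t with h | h
    · rw [height_append_left v w h]; exact h1 i hi h
    · obtain ⟨i, rfl⟩ := Nat.exists_eq_add_of_le h
      rw [height_append_right, h2]
      exact h3 i (by omega)

/-! ### Noncrossing matchings and positive excursions -/

/-- The noncrossing perfect matchings, as involutions. -/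
def IsNoncrossing {M : ℕ} (r : Equiv.Perm (Fin M)) : Prop :=
  (∀ i, r (r i) = i) ∧ (∀ i, r i ≠ i) ∧ ∀ i j, i < j → j < r i → i < r j ∧ r j < r i

/-- The word which records which elements are left ends of arcs. -/
def arcWord {M : ℕ} (r : Equiv.Perm (Fin M)) (i : Fin M) : Bool := decide (i < r i)

lemma letter_arcWord_of_lt {M : ℕ} {r : Equiv.Perm (Fin M)} {i : Fin M} (h : i < r i) :
    letter (arcWord r i) = 1 := by
  simp [arcWord, h]

namespace IsNoncrossing

variable {M : ℕ} {r : Equiv.Perm (Fin M)}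

/-- Pairs inside [a, l) contribute 1 - 1. As `ha` excludes partners below a, the unpaired elements
are left ends of arcs that reach l or beyond. -/
lemma height_sub (h : IsNoncrossing r) {a l : ℕ} (hal : a ≤ l) (hl : l ≤ M)
    (ha : ∀ p : Fin M, a ≤ p.val → p.val < l → a ≤ (r p).val) :
    height (arcWord r) l - height (arcWord r) a =
      (Finset.univ.filter fun p : Fin M => (a ≤ p.val ∧ p.val < l) ∧ l ≤ (r p).val).card := by
  have h1 : height (arcWord r) l - height (arcWord r) a =
      ∑ p : Fin M with a ≤ p.val ∧ p.val < l, letter (arcWord r p) := by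
    rw [sub_eq_iff_eq_add]
    exact partialSum_eq_add _ hal hl
  rw [h1, ← Finset.sum_filter_not_add_sum_filter _ (fun p : Fin M => l ≤ (r p).val),
    Finset.filter_filter, Finset.filter_filter]
  have h2 : ∑ p : Fin M with (a ≤ p.val ∧ p.val < l) ∧ ¬l ≤ (r p).val, letter (arcWord r p) = 0 := by
    refine Finset.sum_involution (fun p _ => r p) ?_ ?_ ?_ ?_
    · intro p _
      have hne := h.2.1 p
      rcases lt_or_gt_of_ne hne with hlt | hlt
      · simp [arcWord, h.1, hlt, hlt.not_gt]
      · simp [arcWord, h.1, hlt, hlt.not_gt]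
    · intro p _ _; exact h.2.1 p
    · intro p hp
      simp only [Finset.mem_filter, Finset.mem_univ, true_and] at hp ⊢
      have := ha p hp.1.1 hp.1.2
      rw [h.1]
      omega
    · intro p _; exact h.1 p
  rw [h2, zero_add, Finset.sum_congr rfl (g := fun _ => (1 : ℤ))]
  · simp
  · intro p hp
    simp only [Finset.mem_filter, Finset.mem_univ, true_and] at hp
    exact letter_arcWord_of_lt (Fin.lt_def.2 (by omega))

/-- The height of the word of a matching is the number of arcs above a given position. -/
lemma height_eq_card (h : IsNoncrossing r) {t : ℕ} (ht : t ≤ M) :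
    height (arcWord r) t =
      (Finset.univ.filter fun p : Fin M => p.val < t ∧ t ≤ (r p).val).card := by
  have := h.height_sub (Nat.zero_le t) ht (fun _ _ _ => Nat.zero_le _)
  simpa using this

end IsNoncrossing

/-- The positions `i ≤ j` are the two ends of an arc above a walk. -/
def IsArc {M : ℕ} (w : Fin M → Bool) (i j : ℕ) : Prop :=
  height w i = height w (j + 1) ∧ i ≤ j ∧ ∀ l, i < l → l ≤ j → height w i < height w l

namespace IsArc

variable {M : ℕ} {w : Fin M → Bool} {i j i' j' : ℕ}

lemma right_unique (h : IsArc w i j) (h' : IsArc w i j') : j = j' := by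
  have aux : ∀ {j j'}, IsArc w i j → IsArc w i j' → ¬j < j' := by
    intro j j' h h' hlt
    have := h'.2.2 (j + 1) (by have := h.2.1; omega) hlt
    rw [h.1] at this
    exact lt_irrefl _ this
  have h1 := aux h h'
  have h2 := aux h' h
  omega

lemma left_unique (h : IsArc w i j) (h' : IsArc w i' j) : i = i' := by
  have aux : ∀ {i i'}, IsArc w i j → IsArc w i' j → ¬i < i' := by
    intro i i' h h' hlt
    have := h.2.2 i' hlt h'.2.1
    rw [h.1, h'.1] at this
    exact lt_irrefl _ this
  have h1 := aux h h'
  have h2 := aux h' h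
  omega

/-- If j < j', position j + 1 would be strictly above the level of i', itself above that of i,
although the walk is back at the level of i there. -/
lemma not_crossing (h : IsArc w i j) (h' : IsArc w i' j') (h1 : i < i') (h2 : i' ≤ j) : j' ≤ j := by
  by_contra! h3
  have h4 := h.2.2 i' h1 h2
  have h5 := h'.2.2 (j + 1) (by omega) (by omega)
  rw [← h.1] at h5
  omega

end IsArc

/-- The elements from i to `r i` are matched among themselves, so no arc survives past `r i`, while
the arc of i keeps the height raised up to that point. -/
lemma IsNoncrossing.isArc {M : ℕ} {r : Equiv.Perm (Fin M)} (h : IsNoncrossing r) {i : Fin M}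
    (hi : i < r i) : IsArc (arcWord r) i (r i) := by
  have hin : ∀ p : Fin M, i ≤ p → p ≤ r i → i ≤ r p ∧ r p ≤ r i := by
    intro p h1 h2
    rcases h1.eq_or_lt with rfl | h1
    · exact ⟨hi.le, le_rfl⟩
    · rcases h2.eq_or_lt with rfl | h2
      · rw [h.1]; exact ⟨le_rfl, hi.le⟩
      · have := h.2.2 i p h1 h2
        exact ⟨this.1.le, this.2.le⟩
  have hi' : i.val < (r i).val := hi
  refine ⟨?_, hi.le, fun l h1 h2 => ?_⟩
  · have := h.height_sub (a := i) (l := r i + 1) (by omega) (r i).2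
      (fun p h1 h2 => (hin p h1 (Fin.le_def.2 (by omega))).1)
    rw [eq_comm, ← sub_eq_zero, this, Nat.cast_eq_zero, Finset.card_eq_zero,
      Finset.filter_eq_empty_iff]
    rintro p - ⟨⟨h1, h2⟩, h3⟩
    have := (hin p h1 (Fin.le_def.2 (by omega))).2
    rw [Fin.le_def] at this
    omega
  · have := h.height_sub (a := i) (l := l) h1.le (by omega)
      (fun p h1 h3 => (hin p h1 (Fin.le_def.2 (by omega))).1)
    rw [← sub_pos, this, Nat.cast_pos, Finset.card_pos]
    exact ⟨i, by simpa using ⟨h1, h2⟩⟩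

/-- The word determines the left ends, and the partner of a left end is its first return, unique by
`IsArc.right_unique`. -/
lemma IsNoncrossing.eq_of_arcWord_eq {M : ℕ} {r r' : Equiv.Perm (Fin M)} (h : IsNoncrossing r)
    (h' : IsNoncrossing r') (hw : arcWord r = arcWord r') : r = r' := by
  have hiff : ∀ i, i < r i ↔ i < r' i := fun i => by
    have := congrFun hw i
    simpa [arcWord] using this
  have hopen : ∀ i, i < r i → r i = r' i := by
    intro i hi
    have h1 := h.isArc hi
    have h2 := h'.isArc ((hiff i).1 hi)
    rw [← hw] at h2
    exact Fin.ext (h1.right_unique h2)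
  refine Equiv.ext fun j => ?_
  by_cases hj : j < r j
  · exact hopen j hj
  · have hlt : r j < r (r j) := by
      rw [h.1]; exact lt_of_le_of_ne (not_lt.1 hj) (h.2.1 j)
    have := hopen _ hlt
    rw [h.1] at this
    conv_rhs => rw [this]
    rw [h'.1]

lemma IsNoncrossing.isArch {N : ℕ} {r : Equiv.Perm (Fin (N + 1))} (h : IsNoncrossing r)
    (h0 : r 0 = Fin.last N) : IsArch (arcWord r) := by
  constructor
  · intro i hi hi'
    rw [h.height_eq_card hi'.le, Nat.cast_pos, Finset.card_pos]
    refine ⟨0, ?_⟩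
    simp only [Finset.mem_filter, Finset.mem_univ, true_and, h0, Fin.val_last]
    exact ⟨hi, by omega⟩
  · rw [h.height_eq_card le_rfl, Nat.cast_eq_zero, Finset.card_eq_zero, Finset.filter_eq_empty_iff]
    rintro p - ⟨-, h1⟩
    exact absurd (r p).2 (by omega)

namespace IsArch

variable {N : ℕ} {w : Fin (N + 1) → Bool}

lemma height_nonneg (hw : IsArch w) {i : ℕ} (hi : i ≤ N + 1) : 0 ≤ height w i := by
  rcases Nat.eq_zero_or_pos i with rfl | h
  · simp
  · rcases hi.lt_or_eq with h' | rfl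
    · exact (hw.1 i h h').le
    · exact hw.2.ge

lemma exists_right (hw : IsArch w) {i : Fin (N + 1)} (hi : w i = true) :
    ∃ j : Fin (N + 1), IsArc w i j ∧ w j = false := by
  classical
  -- The partner is the first step after which the walk is no longer above its level at i; it exists
  -- since the walk ends at 0. Steps being ±1, the level is then attained exactly.
  have hex : ∃ j : ℕ, i ≤ j ∧ height w (j + 1) ≤ height w i :=
    ⟨N, by omega, by rw [hw.2]; exact hw.height_nonneg i.2.le⟩
  set j := Nat.find hex with hj
  have h1 := Nat.find_spec hex
  rw [← hj] at h1
  have hmin : ∀ l : ℕ, i < l → l ≤ j → height w i < height w l := by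
    intro l h2 h3
    have := Nat.find_min hex (m := l - 1) (by omega)
    rw [Nat.sub_add_cancel (by omega)] at this
    push Not at this
    exact this (by omega)
  have hjN : j ≤ N :=
    Nat.find_min' hex ⟨by omega, by rw [hw.2]; exact hw.height_nonneg i.2.le⟩
  have hsi := height_succ w i
  rw [hi, letter_true] at hsi
  have hij : (i : ℕ) < j := by
    rcases h1.1.lt_or_eq with h | h
    · exact h
    · rw [← h] at h1; omega
  have hsj := height_succ w ⟨j, by omega⟩
  simp only at hsj
  have h3 := hmin j hij le_rfl
  cases hwj : w ⟨j, by omega⟩ with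
  | true => rw [hwj, letter_true] at hsj; omega
  | false =>
    rw [hwj, letter_false] at hsj
    exact ⟨⟨j, by omega⟩, ⟨by simp only; omega, hij.le, hmin⟩, hwj⟩

lemma exists_left (hw : IsArch w) {j : Fin (N + 1)} (hj : w j = false) :
    ∃ i : Fin (N + 1), IsArc w i j ∧ w i = true := by
  classical
  -- Symmetrically, the partner is the last time before the step at which the walk is no higher than
  -- just after it.
  set P : ℕ → Prop := fun i => height w i ≤ height w (j + 1) with hP
  set i := Nat.findGreatest P j with hi
  have h0 : P 0 := by simp only [hP, height_zero]; exact hw.height_nonneg j.2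
  have h1 : P i := Nat.findGreatest_spec (Nat.zero_le _) h0
  have hle : i ≤ j := Nat.findGreatest_le _
  have hmax : ∀ l, i < l → l ≤ j → height w (j + 1) < height w l := by
    intro l h2 h3
    have := Nat.findGreatest_is_greatest h2 h3
    simpa [hP] using this
  have hsj := height_succ w j
  rw [hj, letter_false] at hsj
  have hij : i < j := by
    rcases hle.lt_or_eq with h | h
    · exact h
    · rw [h] at h1; simp only [hP] at h1; omega
  have hsi := height_succ w ⟨i, by omega⟩
  simp only at hsi
  have h3 := hmax (i + 1) (by omega) hij
  simp only [hP] at h1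
  cases hwi : w ⟨i, by omega⟩ with
  | false => rw [hwi, letter_false] at hsi; omega
  | true =>
    rw [hwi, letter_true] at hsi
    have heq : height w i = height w (j + 1) := by omega
    exact ⟨⟨i, by omega⟩, ⟨heq, hij.le, fun l h4 h5 => by
      simp only at h4 ⊢; rw [heq]; exact hmax l h4 h5⟩, hwi⟩

/-- Every positive walk is the word of a noncrossing matching. -/
lemma exists_matching (hw : IsArch w) :
    ∃ r : Equiv.Perm (Fin (N + 1)), IsNoncrossing r ∧ r 0 = Fin.last N ∧ arcWord r = w := by
  classical
  have hex : ∀ i : Fin (N + 1), ∃ j : Fin (N + 1),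
      (w i = true → IsArc w i j ∧ w j = false) ∧ (w i = false → IsArc w j i ∧ w j = true) := by
    intro i
    cases h : w i with
    | true =>
      obtain ⟨j, hj⟩ := hw.exists_right h
      exact ⟨j, fun _ => hj, by simp⟩
    | false =>
      obtain ⟨j, hj⟩ := hw.exists_left h
      exact ⟨j, by simp, fun _ => hj⟩
  choose f hf1 hf2 using hex
  have hinv : Function.Involutive f := by
    intro i
    cases h : w i with
    | true =>
      have h1 := hf1 i h
      exact Fin.ext ((hf2 _ h1.2).1.left_unique h1.1)
    | false =>
      have h1 := hf2 i h
      exact Fin.ext ((hf1 _ h1.2).1.right_unique h1.1)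
  have hne : ∀ i, f i ≠ i := by
    intro i h
    cases hwi : w i with
    | true => have h1 := (hf1 i hwi).2; rw [h, hwi] at h1; exact absurd h1 (by simp)
    | false => have h1 := (hf2 i hwi).2; rw [h, hwi] at h1; exact absurd h1 (by simp)
  have hword : ∀ i, i < f i ↔ w i = true := by
    intro i
    constructor
    · intro h
      by_contra hwi
      rw [Bool.not_eq_true] at hwi
      have := (hf2 i hwi).1.2.1
      rw [Fin.lt_def] at h
      omega
    · intro h
      exact lt_of_le_of_ne (Fin.le_def.2 (hf1 i h).1.2.1) (hne i).symm
  refine ⟨hinv.toPerm f, ⟨hinv, hne, ?_⟩, ?_, ?_⟩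
  · intro i j hij hji
    simp only [Function.Involutive.coe_toPerm] at hji ⊢
    have hi := (hf1 i ((hword i).1 (hij.trans hji))).1
    have hij' : i.val < j.val := hij
    have hji' : j.val < (f i).val := hji
    have hne1 : f j ≠ f i := fun h => hij.ne' (hinv.injective h)
    have hne2 : f j ≠ i := fun h => hji.ne (by rw [← h, hinv])
    cases hwj : w j with
    | true =>
      have hj := (hf1 j hwj).1
      have h1 := hi.not_crossing hj hij' hji'.le
      exact ⟨hij.trans ((hword j).2 hwj), lt_of_le_of_ne (Fin.le_def.2 h1) hne1⟩
    | false =>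
      have hj := (hf2 j hwj).1
      have hlt : f j < j := lt_of_le_of_ne (Fin.le_def.2 hj.2.1) (hne j)
      refine ⟨lt_of_le_of_ne (not_lt.1 fun h => ?_) hne2.symm, hlt.trans hji⟩
      have h1 := hj.not_crossing hi h hij'.le
      omega
  · have h0 : w 0 = true := by
      have h1 := height_succ w 0
      cases h : w 0 with
      | true => rfl
      | false =>
        have h2 := hw.height_nonneg (i := 1) (by omega)
        rw [h, letter_false] at h1
        simp only [Fin.val_zero, height_zero, zero_add] at h1
        omega
    have h1 := (hf1 0 h0).1
    have h2 := h1.1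
    refine Fin.ext ?_
    -- A partner of 0 before the end would be an early return to level 0.
    by_contra hlt
    have h3 := hw.1 (f 0 + 1) (by omega) (by
      have := (f 0).2
      have : (f 0).val ≠ N := hlt
      omega)
    rw [Fin.val_zero, height_zero] at h2
    omega
  · funext i
    have := hword i
    cases h : w i <;> simp_all [arcWord]

end IsArch

/-- The matchings with `k` arcs above a given position. -/
lemma card_isNoncrossing {N t s k : ℕ} (hN : N + 1 = t + s) (hk : 0 < k) :
    Nat.card {r : Equiv.Perm (Fin (N + 1)) // (IsNoncrossing r ∧ r 0 = Fin.last N) ∧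
      Nat.card {p : Fin (N + 1) // p.val < t ∧ t ≤ (r p).val} = k} =
      firstPassage t k * firstPassage s k := by
  rw [← card_isArch hN hk]
  have hcard : ∀ {r : Equiv.Perm (Fin (N + 1))}, IsNoncrossing r →
      (Nat.card {p : Fin (N + 1) // p.val < t ∧ t ≤ (r p).val} = k ↔
        height (arcWord r) t = k) := by
    intro r h
    rw [h.height_eq_card (by omega), Nat.card_eq_fintype_card, Fintype.card_subtype, Nat.cast_inj]
  refine Nat.card_eq_of_bijective (fun r => ⟨arcWord r.1, r.2.1.1.isArch r.2.1.2,
    (hcard r.2.1.1).1 r.2.2⟩) ⟨fun r r' h => ?_, fun w => ?_⟩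
  · exact Subtype.ext (r.2.1.1.eq_of_arcWord_eq r'.2.1.1 (congrArg Subtype.val h))
  · obtain ⟨r, h1, h2, h3⟩ := w.2.1.exists_matching
    exact ⟨⟨r, ⟨h1, h2⟩, (hcard h1).2 (by rw [h3]; exact w.2.2)⟩, Subtype.ext h3⟩

lemma Equiv.Perm.SameCycle.apply_eq {α β : Type*} {f : Equiv.Perm α} {g : α → β}
    (hg : ∀ x, g (f x) = g x) {x y : α} (h : f.SameCycle x y) : g x = g y := by
  obtain ⟨i, rfl⟩ := h
  induction i with
  | zero => simp
  | succ i ih => rw [add_comm, zpow_add, zpow_one, Equiv.Perm.mul_apply, hg, ih]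
  | pred i ih =>
    rw [← hg ((f ^ (-(i : ℤ) - 1)) x), ← Equiv.Perm.mul_apply, ← zpow_one_add, ih]
    congr 3
    ring

/-! ### Standard numbering of a unicycle pointed on its cycle -/

section

variable {N : ℕ} {t : Fin (N + 1)}

/-- The cyclic rotation of the elements below `t` and of the other elements. -/
def twoCycleFun (t : Fin (N + 1)) (i : Fin (N + 1)) : Fin (N + 1) :=
  if i.val + 1 = t.val then 0 else if h : i.val + 1 < N + 1 then ⟨i + 1, h⟩ else t

lemma val_twoCycleFun (i : Fin (N + 1)) : (twoCycleFun t i).val =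
    if i.val + 1 = t.val then 0 else if i.val + 1 < N + 1 then i.val + 1 else t.val := by
  unfold twoCycleFun
  split_ifs <;> rfl

lemma twoCycleFun_injective (ht : 0 < t.val) : Function.Injective (twoCycleFun t) := by
  intro i j h
  have h := congrArg Fin.val h
  refine Fin.ext ?_
  rw [val_twoCycleFun, val_twoCycleFun] at h
  split_ifs at h <;> omega

/-- The permutation whose cycles are the elements below `t` and the other elements, in order. -/
noncomputable def twoCycle (t : Fin (N + 1)) (ht : 0 < t.val) : Equiv.Perm (Fin (N + 1)) :=
  Equiv.ofBijective (twoCycleFun t) (Finite.injective_iff_bijective.1 (twoCycleFun_injective ht))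

variable {ht : 0 < t.val}

lemma twoCycle_of_eq {i : Fin (N + 1)} (h : i.val + 1 = t.val) : twoCycle t ht i = 0 :=
  if_pos h

lemma twoCycle_of_ne {i : Fin (N + 1)} (h : i.val + 1 ≠ t.val) (h' : i.val + 1 < N + 1) :
    twoCycle t ht i = ⟨i + 1, h'⟩ :=
  (if_neg h).trans (dif_pos h')

lemma twoCycle_last : twoCycle t ht (Fin.last N) = t :=
  (if_neg (by have := t.2; simp only [Fin.val_last]; omega)).trans (dif_neg (by simp))

/-- The values of a permutation like `twoCycle`, except at `t - 1`. -/
lemma twoCycle_cases (i : Fin (N + 1)) : (i.val + 1 = t.val ∧ twoCycle t ht i = 0) ∨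
    (i.val + 1 ≠ t.val ∧ ∃ h : i.val + 1 < N + 1, twoCycle t ht i = ⟨i + 1, h⟩) ∨
    (i = Fin.last N ∧ twoCycle t ht i = t) := by
  by_cases h : i.val + 1 = t.val
  · exact Or.inl ⟨h, twoCycle_of_eq h⟩
  · by_cases h' : i.val + 1 < N + 1
    · exact Or.inr (Or.inl ⟨h, h', twoCycle_of_ne h h'⟩)
    · obtain rfl : i = Fin.last N := Fin.ext (by simp only [Fin.val_last]; omega)
      exact Or.inr (Or.inr ⟨rfl, twoCycle_last⟩)

lemma twoCycle_lt_iff (i : Fin (N + 1)) : twoCycle t ht i < t ↔ i < t := by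
  have := t.2
  rcases twoCycle_cases (ht := ht) i with ⟨h1, h2⟩ | ⟨h1, h2, h3⟩ | ⟨h1, h2⟩
  · rw [h2, Fin.lt_def, Fin.lt_def, Fin.val_zero]; omega
  · rw [h3, Fin.lt_def, Fin.lt_def]; simp only; omega
  · rw [h2, h1, Fin.lt_def, Fin.lt_def, Fin.val_last]; omega

lemma CombMap.leftFace_eq_iff_of_faceNext_eq {m : CombMap (Fin (N + 1))}
    (hm : m.faceNext = twoCycle t ht) (i j : Fin (N + 1)) :
    m.leftFace i = m.leftFace j ↔ (i < t ↔ j < t) := by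
  constructor
  · intro h
    rw [m.leftFace_eq_iff, hm] at h
    exact iff_of_eq (h.apply_eq (g := fun i => i < t) fun i => propext (twoCycle_lt_iff i))
  · have h1 : ∀ (i : ℕ) (hi : i < N + 1), i < t.val → m.leftFace ⟨i, hi⟩ = m.leftFace 0 := by
      intro i
      induction i with
      | zero => intros; rfl
      | succ i ih =>
        intro hi hit
        rw [← ih (by omega) (by omega), ← m.leftFace_faceNext ⟨i, by omega⟩, hm,
          twoCycle_of_ne (by simp only; omega) hi]
    have h2 : ∀ (i : ℕ) (hi : i < N + 1), t.val ≤ i → m.leftFace ⟨i, hi⟩ = m.leftFace t := by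
      intro i
      induction i with
      | zero => intros; omega
      | succ i ih =>
        intro hi hit
        rcases hit.eq_or_lt with h | h
        · congr 1; exact Fin.ext h.symm
        · rw [← ih (by omega) (by omega), ← m.leftFace_faceNext ⟨i, by omega⟩, hm,
            twoCycle_of_ne (by simp only; omega) hi]
    intro h
    by_cases hi : i < t
    · rw [h1 i i.2 hi, h1 j j.2 (h.1 hi)]
    · rw [h2 i i.2 (not_lt.1 hi), h2 j j.2 (not_lt.1 fun hj => hi (h.2 hj))]

/-- The darts of the unicycle are listed along the external face, from the reversal of the
distinguished edge, and then along the internal face, with the distinguished edge at the end. -/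
structure Unicycle.IsStandard (u : Unicycle (Fin (N + 1))) (t : Fin (N + 1)) (ht : 0 < t.val) :
    Prop where
  faceNext_eq : u.faceNext = twoCycle t ht
  rev_last : u.rev (Fin.last N) = 0
  isCycleDart : u.IsCycleDart (Fin.last N)

namespace Unicycle.IsStandard

variable {u : Unicycle (Fin (N + 1))}

lemma rev_zero (hu : u.IsStandard t ht) : u.rev 0 = Fin.last N := by
  rw [← hu.rev_last, u.rev_rev]

lemma leftFace_zero (hu : u.IsStandard t ht) : u.leftFace 0 = u.external := by
  rw [← hu.isCycleDart.2, CombMap.rightFace, hu.rev_last]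

lemma leftFace_eq_external_iff (hu : u.IsStandard t ht) (i : Fin (N + 1)) :
    u.leftFace i = u.external ↔ i < t := by
  rw [← hu.leftFace_zero, CombMap.leftFace_eq_iff_of_faceNext_eq hu.faceNext_eq]
  have : (0 : Fin (N + 1)) < t := ht
  simp [this]

lemma leftFace_eq_internal_iff (hu : u.IsStandard t ht) (i : Fin (N + 1)) :
    u.leftFace i = u.internal ↔ ¬i < t := by
  rw [← u.not_eq_external_iff, Ne, hu.leftFace_eq_external_iff]

lemma isCycleDart_iff (hu : u.IsStandard t ht) (i : Fin (N + 1)) :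
    u.IsCycleDart i ↔ t ≤ i ∧ u.rev i < t := by
  rw [IsCycleDart, hu.leftFace_eq_internal_iff, CombMap.rightFace, hu.leftFace_eq_external_iff,
    not_lt]

/-- Reversal carries the cycle darts, numbered t or more, to the left ends of the arcs above
position t. -/
lemma cycleLength_eq (hu : u.IsStandard t ht) :
    u.cycleLength = Nat.card {p : Fin (N + 1) // p.val < t ∧ t.val ≤ (u.rev p).val} := by
  refine Nat.card_congr (Equiv.subtypeEquiv u.rev fun i => ?_)
  rw [hu.isCycleDart_iff, u.rev_rev, Fin.le_def, Fin.lt_def, and_comm]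

/-- Partial sums along the numbering are the values of a potential of δ at the origins of darts. The
passage from one face to the other is consistent, because dart t starts at the origin of dart 0 and
the partial sum is 0 there. -/
lemma partialSum_rev (hu : u.IsStandard t ht) {δ : Fin (N + 1) → ℚ}
    (hδ : ∀ d, δ (u.rev d) = -δ d) (h0 : partialSum δ t = 0) (i : Fin (N + 1)) :
    partialSum δ (u.rev i) = partialSum δ (i + 1) := by
  classical
  obtain ⟨f, hf⟩ := u.exists_grad_eq u.external hδ (by
    simp only [hu.leftFace_eq_external_iff]
    rw [← h0, partialSum_eq_sum _ t.2.le]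
    rfl)
  have hgrad : ∀ d, f (u.target d) = f (u.origin d) + δ d := fun d => by
    rw [← hf, CombMap.grad_apply]; ring
  have key : ∀ (i : ℕ) (hi : i < N + 1), f (u.origin ⟨i, hi⟩) = f (u.origin 0) + partialSum δ i := by
    intro i
    induction i with
    | zero => intro _; simp
    | succ i ih =>
      intro hi
      by_cases h : i + 1 = t.val
      · have h1 : (⟨i + 1, hi⟩ : Fin (N + 1)) = u.faceNext (Fin.last N) := by
          rw [hu.faceNext_eq, twoCycle_last]; exact Fin.ext h
        rw [h1, u.origin_faceNext, ← u.origin_rev, hu.rev_last, h, h0, add_zero]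
      · have h1 : (⟨i + 1, hi⟩ : Fin (N + 1)) = u.faceNext ⟨i, by omega⟩ := by
          rw [hu.faceNext_eq, twoCycle_of_ne h hi]
        rw [h1, u.origin_faceNext, hgrad, ih, add_assoc, ← partialSum_succ δ ⟨i, by omega⟩]
  have h1 := key (u.rev i) (u.rev i).2
  have h2 := key i i.2
  rw [Fin.eta] at h1 h2
  rw [u.origin_rev, hgrad, h2] at h1
  rw [partialSum_succ]
  linarith

/-- `partialSum_rev` is applied to a function supported on the edge of a and on the distinguished
edge. Between a and `rev a` the partial sums of `single a` equal 1, and they must take the same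
value at `rev j` as just after j, so `rev j` lies between a and `rev a` too. -/
lemma isNoncrossing (hu : u.IsStandard t ht) : IsNoncrossing u.rev := by
  refine ⟨u.rev_rev, u.rev_ne, fun a j haj hjb => ?_⟩
  have hsingle : ∀ (a : Fin (N + 1)) {l : ℕ}, l ≤ N + 1 → partialSum (u.single a) l =
      (if a.val < l then 1 else 0) - (if (u.rev a).val < l then 1 else 0) := by
    intro a l hl
    rw [partialSum_eq_sum _ hl]
    simp only [CombMap.single, Finset.sum_sub_distrib, Finset.sum_ite_eq', Finset.mem_filter,
      Finset.mem_univ, true_and]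
  -- Subtracting c times `single 0` cancels the circulation along the external face, and shifts
  -- partial sums by the same constant at all positions from 1 to N.
  set c := partialSum (u.single a) t with hc
  set δ : Fin (N + 1) → ℚ := fun d => u.single a d - c * u.single 0 d with hδ
  have hlin : ∀ {l : ℕ}, l ≤ N + 1 →
      partialSum δ l = partialSum (u.single a) l - c * partialSum (u.single 0) l := by
    intro l hl
    rw [partialSum_eq_sum _ hl, partialSum_eq_sum _ hl, partialSum_eq_sum _ hl, hδ,
      Finset.sum_sub_distrib, Finset.mul_sum]
  have ht2 := t.2
  have hj0 : u.rev j ≠ 0 := by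
    intro h
    have : j = Fin.last N := by rw [← hu.rev_zero, ← h, u.rev_rev]
    rw [this] at hjb
    exact absurd (Fin.le_last (u.rev a)) (not_le.2 hjb)
  have hjN : u.rev j ≠ Fin.last N := by
    intro h
    have : j = 0 := by rw [← hu.rev_last, ← h, u.rev_rev]
    rw [this] at haj
    exact absurd (Fin.zero_le a) (not_le.2 haj)
  have hlt : (u.rev j).val < N := Fin.val_lt_last hjN
  have hpos : 0 < (u.rev j).val := Fin.pos_iff_ne_zero.2 hj0
  have haj' : a.val < j.val := haj
  have hjb' : j.val < (u.rev a).val := hjb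
  have hb2 := (u.rev a).2
  have h := hu.partialSum_rev (δ := δ) (fun d => by
    rw [hδ]
    simp only [u.single_mem_antisymm _ d]
    ring) (by
    rw [hlin ht2.le, hsingle 0 ht2.le, hu.rev_zero, Fin.val_zero, Fin.val_last, if_pos ht,
      if_neg (by omega), ← hc]
    ring) j
  rw [hlin (u.rev j).2.le, hlin j.2, hsingle a j.2, hsingle 0 j.2, hsingle a (u.rev j).2.le,
    hsingle 0 (u.rev j).2.le, hu.rev_zero, Fin.val_zero, Fin.val_last, if_pos hpos,
    if_neg (by omega : ¬N < (u.rev j).val), if_pos (by omega : 0 < j.val + 1),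
    if_neg (by omega : ¬N < j.val + 1), if_pos (by omega : a.val < j.val + 1),
    if_neg (by omega : ¬(u.rev a).val < j.val + 1)] at h
  have hab : u.rev j ≠ u.rev a := fun h => haj.ne' (u.rev.injective h)
  rw [Fin.lt_def]
  split_ifs at h with h1 h2 h2
  · linarith
  · exact ⟨h1, lt_of_le_of_ne (Fin.le_def.2 (by omega)) hab⟩
  · linarith
  · linarith

end Unicycle.IsStandard

end

/-! ### The unicycle of a noncrossing matching -/

namespace IsNoncrossing

section

variable {M : ℕ} {r : Equiv.Perm (Fin M)} {δ : Fin M → ℚ}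

lemma partialSum_total (h : IsNoncrossing r) (hδ : ∀ d, δ (r d) = -δ d) : partialSum δ M = 0 := by
  rw [partialSum_eq_sum _ le_rfl]
  refine Finset.sum_involution (fun p _ => r p) ?_ ?_ ?_ ?_
  · intro p _; rw [hδ]; ring
  · intro p _ _; exact h.2.1 p
  · intro p _; simp
  · intro p _; exact h.1 p

/-- Elements strictly between the two ends of an arc are matched among themselves, so their
contributions cancel. -/
lemma partialSum_succ_apply (h : IsNoncrossing r) (hδ : ∀ d, δ (r d) = -δ d) (j : Fin M) :
    partialSum δ (r j + 1) = partialSum δ j := by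
  have key : ∀ i, i < r i → partialSum δ (r i) = partialSum δ (i + 1) := by
    intro i hi
    rw [partialSum_eq_add δ (a := i + 1) hi (r i).2.le, add_eq_right]
    refine Finset.sum_involution (fun p _ => r p) ?_ ?_ ?_ ?_
    · intro p _; rw [hδ]; ring
    · intro p _ _; exact h.2.1 p
    · intro p hp
      simp only [Finset.mem_filter, Finset.mem_univ, true_and] at hp ⊢
      exact h.2.2 i p hp.1 hp.2
    · intro p _; exact h.1 p
  by_cases hj : j < r j
  · rw [partialSum_succ, key j hj, partialSum_succ, hδ]; ring
  · have hlt : r j < r (r j) := by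
      rw [h.1]; exact lt_of_le_of_ne (not_lt.1 hj) (h.2.1 j)
    have := key _ hlt
    rw [h.1] at this
    exact this.symm

end

variable {N : ℕ}

/-- The map whose edges are the pairs of a noncrossing matching of two cycles. -/
noncomputable def combMap {r : Equiv.Perm (Fin (N + 1))} (h : IsNoncrossing r)
    (h0 : r 0 = Fin.last N) (t : Fin (N + 1)) (ht : 0 < t.val) : CombMap (Fin (N + 1)) where
  rev := r
  rot := twoCycle t ht * r
  rev_rev := h.1
  rev_ne := h.2.1
  connected := by
    set S := Subgroup.closure ({r, twoCycle t ht * r} : Set (Equiv.Perm (Fin (N + 1)))) with hS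
    have hr : r ∈ S := Subgroup.subset_closure (by simp)
    have hrot : twoCycle t ht * r ∈ S := Subgroup.subset_closure (by simp)
    have hφ : twoCycle t ht ∈ S := by
      have := S.mul_mem hrot (S.inv_mem hr)
      rwa [mul_inv_cancel_right] at this
    have key : ∀ (i : ℕ) (hi : i < N + 1), ∃ g ∈ S, g 0 = ⟨i, hi⟩ := by
      intro i
      induction i with
      | zero => exact fun _ => ⟨1, S.one_mem, rfl⟩
      | succ i ih =>
        intro hi
        -- The arc from 0 to the last element is what connects the two faces: `rot` sends 0 to t.
        by_cases hit : i + 1 = t.val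
        · refine ⟨twoCycle t ht * r, hrot, ?_⟩
          rw [Equiv.Perm.mul_apply, h0, twoCycle_last]
          exact Fin.ext hit.symm
        · obtain ⟨g, hg, hg0⟩ := ih (by omega)
          exact ⟨twoCycle t ht * g, S.mul_mem hφ hg, by
            rw [Equiv.Perm.mul_apply, hg0, twoCycle_of_ne hit hi]⟩
    intro d d'
    obtain ⟨g, hg, hgd⟩ := key d d.2
    obtain ⟨g', hg', hgd'⟩ := key d' d'.2
    rw [Fin.eta] at hgd hgd'
    refine ⟨g' * g⁻¹, S.mul_mem hg' (S.inv_mem hg), ?_⟩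
    rw [Equiv.Perm.mul_apply, ← hgd, Equiv.Perm.inv_def, Equiv.symm_apply_apply, hgd']

section

variable {t : Fin (N + 1)} {ht : 0 < t.val} {r : Equiv.Perm (Fin (N + 1))} (h : IsNoncrossing r)
  (h0 : r 0 = Fin.last N)

lemma faceNext_combMap : (h.combMap h0 t ht).faceNext = twoCycle t ht :=
  Equiv.ext fun i => congrArg (twoCycle t ht) (h.1 i)

lemma leftFace_combMap_zero_ne_last :
    (h.combMap h0 t ht).leftFace 0 ≠ (h.combMap h0 t ht).leftFace (Fin.last N) := by
  rw [Ne, CombMap.leftFace_eq_iff_of_faceNext_eq (h.faceNext_combMap h0)]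
  have h1 : (0 : Fin (N + 1)) < t := ht
  simp [h1, Fin.le_last]

lemma leftFace_combMap_eq_or_eq (f : (h.combMap h0 t ht).Face) :
    f = (h.combMap h0 t ht).leftFace (Fin.last N) ∨ f = (h.combMap h0 t ht).leftFace 0 := by
  obtain ⟨d, rfl⟩ := (h.combMap h0 t ht).leftFace_surjective f
  rw [CombMap.leftFace_eq_iff_of_faceNext_eq (h.faceNext_combMap h0),
    CombMap.leftFace_eq_iff_of_faceNext_eq (h.faceNext_combMap h0)]
  have h1 : (0 : Fin (N + 1)) < t := ht
  have h2 : ¬Fin.last N < t := not_lt.2 (Fin.le_last t)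
  simp only [h1, h2, iff_true, iff_false]
  exact em' _

/-- By the two-face criterion it suffices to integrate δ. Its partial sums are constant on the
cycles of `rot`, hence define a function on vertices whose gradient is δ. -/
lemma isPlanar_combMap : (h.combMap h0 t ht).IsPlanar := by
  classical
  set m := h.combMap h0 t ht with hm
  have hcard : Nat.card m.Face = 2 := by
    rw [Nat.card_eq_two_iff]
    exact ⟨_, _, (h.leftFace_combMap_zero_ne_last h0).symm,
      Set.eq_univ_of_forall (h.leftFace_combMap_eq_or_eq h0)⟩
  rw [m.isPlanar_iff_of_two_faces hcard (m.leftFace 0)]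
  intro δ hδ hsum
  have hδ' : ∀ d, δ (r d) = -δ d := hδ
  have h1 : (0 : Fin (N + 1)) < t := ht
  have hpt : partialSum δ t = 0 := by
    rw [← hsum, partialSum_eq_sum _ t.2.le]
    refine Finset.sum_congr (Finset.filter_congr fun i _ => ?_) fun _ _ => rfl
    rw [hm, CombMap.leftFace_eq_iff_of_faceNext_eq (h.faceNext_combMap h0)]
    simp only [h1, iff_true]
    rfl
  -- Closing up a face is harmless: the partial sum vanishes at t by hypothesis, and at the end
  -- because paired darts cancel.
  have hface : ∀ i, partialSum δ (twoCycle t ht i) = partialSum δ (i + 1) := by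
    intro i
    rcases twoCycle_cases (ht := ht) i with ⟨h1, h2⟩ | ⟨h1, h2, h3⟩ | ⟨h1, h2⟩
    · rw [h2, h1, hpt]; rfl
    · rw [h3]
    · rw [h2, h1, hpt, Fin.val_last, h.partialSum_total hδ']
  have hrot : ∀ i, partialSum δ (m.rot i) = partialSum δ i := fun i =>
    (hface (r i)).trans (h.partialSum_succ_apply hδ' i)
  refine ⟨Quotient.lift (fun i : Fin (N + 1) => partialSum δ i)
    fun a b hab => Equiv.Perm.SameCycle.apply_eq (g := fun i : Fin (N + 1) => partialSum δ i)
      hrot hab, funext fun i => ?_⟩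
  change partialSum δ (r i) - partialSum δ i = δ i
  have h2 := h.partialSum_succ_apply hδ' (r i)
  rw [h.1, partialSum_succ] at h2
  rw [← h2]
  ring

/-- The unicycle which is encoded by a noncrossing matching of two cycles. -/
noncomputable def unicycle (t : Fin (N + 1)) (ht : 0 < t.val) : Unicycle (Fin (N + 1)) where
  toCombMap := h.combMap h0 t ht
  planar := h.isPlanar_combMap h0
  internal := (h.combMap h0 t ht).leftFace (Fin.last N)
  external := (h.combMap h0 t ht).leftFace 0
  internal_ne_external := (h.leftFace_combMap_zero_ne_last h0).symm
  eq_or_eq := h.leftFace_combMap_eq_or_eq h0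

lemma isStandard_unicycle : (h.unicycle h0 t ht).IsStandard t ht := by
  have hlast : r (Fin.last N) = 0 := by rw [← h0, h.1]
  exact ⟨h.faceNext_combMap h0, hlast, rfl, congrArg (h.combMap h0 t ht).leftFace hlast⟩

end

end IsNoncrossing

/-! ### Reduction of pointed unicycles to standard ones -/

namespace Unicycle

lemma relabel_inv_relabel {D : Type} (u : Unicycle D) (e : Equiv.Perm D) :
    (u.relabel e⁻¹).relabel e = u := by
  have he : ∀ d, e (e⁻¹ d) = d := e.apply_symm_apply
  refine ext_of_darts (Equiv.ext fun d => ?_) (Equiv.ext fun d => ?_) (fun d => ?_) fun d => ?_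
  · obtain ⟨d, rfl⟩ : ∃ d', e (e⁻¹ d') = d := ⟨d, he d⟩
    refine ((u.relabel e⁻¹).relabel_rev e _).trans ((congrArg e (u.relabel_rev e⁻¹ d)).trans ?_)
    rw [he, he]
  · obtain ⟨d, rfl⟩ : ∃ d', e (e⁻¹ d') = d := ⟨d, he d⟩
    refine ((u.relabel e⁻¹).relabel_rot e _).trans ((congrArg e (u.relabel_rot e⁻¹ d)).trans ?_)
    rw [he, he]
  · have h1 := (u.relabel e⁻¹).relabel_leftFace_eq_internal e (e⁻¹ d)
    rw [he, u.relabel_leftFace_eq_internal] at h1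
    exact h1
  · have h1 := (u.relabel e⁻¹).relabel_leftFace_eq_external e (e⁻¹ d)
    rw [he, u.relabel_leftFace_eq_external] at h1
    exact h1

lemma cycleLength_relabel {D : Type} (u : Unicycle D) (e : Equiv.Perm D) :
    (u.relabel e).cycleLength = u.cycleLength :=
  (Nat.card_congr (Equiv.subtypeEquiv e fun d => (u.relabel_isCycleDart e d).symm)).symm

end Unicycle

namespace CombMap

variable {D : Type} (m : CombMap D)

lemma exists_iterate_faceNext [Finite D] {a d : D} (h : m.leftFace a = m.leftFace d) :
    ∃ i < Function.minimalPeriod m.faceNext a, m.faceNext^[i] a = d := by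
  obtain ⟨i, hi⟩ := ((m.leftFace_eq_iff).1 h).exists_nat_pow_eq
  rw [← Equiv.Perm.iterate_eq_pow] at hi
  refine ⟨i % Function.minimalPeriod m.faceNext a, Nat.mod_lt _ ?_, ?_⟩
  · exact Function.minimalPeriod_pos_of_mem_periodicPts (m.faceNext.injective.mem_periodicPts a)
  · rw [Function.iterate_mod_minimalPeriod_eq, hi]

lemma leftFace_iterate_faceNext (i : ℕ) (a : D) : m.leftFace (m.faceNext^[i] a) = m.leftFace a := by
  induction i with
  | zero => rfl
  | succ i ih => rw [Function.iterate_succ_apply', leftFace_faceNext, ih]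

end CombMap

namespace Unicycle

variable {N : ℕ} (u : Unicycle (Fin (N + 1))) {d₀ : Fin (N + 1)}

/-- The lengths of the two faces of a unicycle add up to the number of darts. -/
lemma minimalPeriod_add_minimalPeriod {D : Type} [Finite D] {u : Unicycle D} {d₀ : D}
    (h : u.IsCycleDart d₀) :
    Function.minimalPeriod u.faceNext (u.rev d₀) + Function.minimalPeriod u.faceNext d₀ =
      Nat.card D := by
  set t := Function.minimalPeriod u.faceNext (u.rev d₀)
  set s := Function.minimalPeriod u.faceNext d₀
  have hext : u.leftFace (u.rev d₀) = u.external := h.2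
  have hb : Function.Bijective (Sum.elim (fun i : Fin t => u.faceNext^[i] (u.rev d₀))
      (fun i : Fin s => u.faceNext^[i] d₀)) := by
    constructor
    · refine Function.Injective.sumElim ?_ ?_ fun i j hij => ?_
      · exact fun i j hij => Fin.ext (Function.iterate_injOn_Iio_minimalPeriod i.2 j.2 hij)
      · exact fun i j hij => Fin.ext (Function.iterate_injOn_Iio_minimalPeriod i.2 j.2 hij)
      · have := congrArg u.leftFace hij
        rw [u.leftFace_iterate_faceNext, u.leftFace_iterate_faceNext, hext, h.1] at this
        exact u.internal_ne_external this.symm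
    · intro d
      rcases u.eq_or_eq (u.leftFace d) with hd | hd
      · obtain ⟨i, hi, rfl⟩ := u.exists_iterate_faceNext (h.1.trans hd.symm)
        exact ⟨Sum.inr ⟨i, hi⟩, rfl⟩
      · obtain ⟨i, hi, rfl⟩ := u.exists_iterate_faceNext (hext.trans hd.symm)
        exact ⟨Sum.inl ⟨i, hi⟩, rfl⟩
  have := Nat.card_eq_of_bijective _ hb
  rwa [Nat.card_sum, Nat.card_eq_fintype_card, Nat.card_eq_fintype_card, Fintype.card_fin,
    Fintype.card_fin] at this

/-- Every unicycle with a distinguished edge on the cycle is a renaming of a standard one. -/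
lemma exists_isStandard_relabel (h : u.IsCycleDart d₀) :
    ∃ (e : Equiv.Perm (Fin (N + 1))) (t : Fin (N + 1)) (ht : 0 < t.val),
      (u.relabel e⁻¹).IsStandard t ht ∧ e (Fin.last N) = d₀ := by
  have hsum := minimalPeriod_add_minimalPeriod h
  rw [Nat.card_eq_fintype_card, Fintype.card_fin] at hsum
  have hpos : ∀ d, 0 < Function.minimalPeriod u.faceNext d := fun d =>
    Function.minimalPeriod_pos_of_mem_periodicPts (u.faceNext.injective.mem_periodicPts d)
  have ht0 := hpos (u.rev d₀)
  have hs0 := hpos d₀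
  set φ := u.faceNext with hφ
  set x₀ := u.rev d₀ with hx
  set t := Function.minimalPeriod φ x₀ with ht
  set s := Function.minimalPeriod φ d₀ with hs
  have hext : u.leftFace x₀ = u.external := h.2
  -- The external face starts at `x₀`, but the internal one starts one step after `d₀`, so that `d₀`
  -- comes last.
  set E : Fin (N + 1) → Fin (N + 1) := fun i =>
    if i.val < t then φ^[i] x₀ else φ^[i - t + 1] d₀ with hE
  have hE1 : ∀ i : Fin (N + 1), i.val < t → E i = φ^[i] x₀ := fun i hi => if_pos hi
  have hE2 : ∀ i : Fin (N + 1), ¬i.val < t → E i = φ^[i - t + 1] d₀ := fun i hi => if_neg hi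
  have hf1 : ∀ i : Fin (N + 1), i.val < t → u.leftFace (E i) = u.external := fun i hi => by
    rw [hE1 i hi, u.leftFace_iterate_faceNext, hext]
  have hf2 : ∀ i : Fin (N + 1), ¬i.val < t → u.leftFace (E i) = u.internal := fun i hi => by
    rw [hE2 i hi, u.leftFace_iterate_faceNext, h.1]
  have hinj : Function.Injective E := by
    intro i j hij
    by_cases hi : i.val < t <;> by_cases hj : j.val < t
    · rw [hE1 i hi, hE1 j hj] at hij
      exact Fin.ext (Function.iterate_injOn_Iio_minimalPeriod hi hj hij)
    · have := hf1 i hi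
      rw [hij, hf2 j hj] at this
      exact absurd this u.internal_ne_external
    · have := hf2 i hi
      rw [hij, hf1 j hj] at this
      exact absurd this.symm u.internal_ne_external
    · rw [hE2 i hi, hE2 j hj, Function.iterate_succ_apply', Function.iterate_succ_apply'] at hij
      have := Function.iterate_injOn_Iio_minimalPeriod (f := φ) (x := d₀)
        (show i.val - t ∈ Set.Iio s by rw [Set.mem_Iio]; omega)
        (show j.val - t ∈ Set.Iio s by rw [Set.mem_Iio]; omega) (φ.injective hij)
      exact Fin.ext (by omega)
  set e : Equiv.Perm (Fin (N + 1)) :=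
    Equiv.ofBijective E (Finite.injective_iff_bijective.1 hinj) with he
  have heE : ∀ i, e i = E i := fun _ => rfl
  have hlast : e (Fin.last N) = d₀ := by
    rw [heE, hE2 _ (by simp only [Fin.val_last]; omega), Fin.val_last,
      show N - t + 1 = s by omega]
    exact Function.iterate_minimalPeriod
  have hzero : e 0 = x₀ := by rw [heE, hE1 0 ht0]; rfl
  have htN : t < N + 1 := by omega
  have hstep : ∀ i, e (twoCycle (⟨t, htN⟩ : Fin (N + 1)) ht0 i) = φ (e i) := by
    intro i
    have hi := i.2
    rcases twoCycle_cases (t := (⟨t, htN⟩ : Fin (N + 1))) (ht := ht0) i with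
      ⟨h1, h2⟩ | ⟨h1, h2, h3⟩ | ⟨h1, h2⟩
    · simp only at h1
      rw [h2, hzero, heE, hE1 i (by omega), ← Function.iterate_succ_apply' φ, Nat.succ_eq_add_one, h1]
      exact Function.iterate_minimalPeriod.symm
    · simp only at h1
      rw [h3, heE, heE]
      by_cases hit : i.val < t
      · rw [hE1 i hit, hE1 _ (by simp only; omega), ← Function.iterate_succ_apply' φ]
      · rw [hE2 i hit, hE2 _ (by simp only; omega), ← Function.iterate_succ_apply' φ]
        simp only
        rw [Nat.succ_eq_add_one, show i.val + 1 - t + 1 = i.val - t + 1 + 1 by omega]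
    · rw [h2, h1, hlast, heE, hE2 _ (by simp)]
      simp
  have hinv : ∀ d, e⁻¹ (e d) = d := e.symm_apply_apply
  refine ⟨e, ⟨t, htN⟩, ht0, ⟨?_, ?_, ?_⟩, hlast⟩
  · refine Equiv.ext fun i => ?_
    have h1 : (u.relabel e⁻¹).faceNext = e⁻¹ * φ * e⁻¹⁻¹ := u.toCombMap.faceNext_relabel e⁻¹
    rw [h1, inv_inv, Equiv.Perm.mul_apply, Equiv.Perm.mul_apply, ← hstep, hinv]
  · have h1 := u.toCombMap.relabel_rev e⁻¹ d₀
    rw [← hx, ← hzero, ← hlast, hinv, hinv] at h1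
    exact h1
  · have h1 := (u.relabel_isCycleDart e⁻¹ d₀).2 h
    rwa [← hlast, hinv] at h1

end Unicycle

/-- Agreement spreads from 0 along the first cycle. If t < t', the shorter cycle closes after t - 1
while the other one moves on to t, so `e'` would take the same value at 0 and at t. -/
lemma not_lt_of_twoCycle_comm {N : ℕ} {t t' : Fin (N + 1)} {ht : 0 < t.val} {ht' : 0 < t'.val}
    {e e' : Equiv.Perm (Fin (N + 1))} (h0 : e 0 = e' 0)
    (hstep : ∀ i, e i = e' i → e (twoCycle t ht i) = e' (twoCycle t' ht' i)) : ¬t < t' := by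
  intro hlt
  have ht2 := t'.2
  have hlt' : t.val < t'.val := hlt
  have key : ∀ (i : ℕ) (hi : i < N + 1), i < t.val → e ⟨i, hi⟩ = e' ⟨i, hi⟩ := by
    intro i
    induction i with
    | zero => exact fun _ _ => h0
    | succ i ih =>
      intro hi hit
      have := hstep _ (ih (by omega) (by omega))
      rwa [twoCycle_of_ne (by simp only; omega) hi, twoCycle_of_ne (by simp only; omega) hi] at this
  have h1 := hstep ⟨t.val - 1, by omega⟩ (key _ _ (by omega))
  rw [twoCycle_of_eq (by simp only; omega), twoCycle_of_ne (by simp only; omega)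
    (by simp only; omega), h0] at h1
  have := congrArg Fin.val (e'.injective h1)
  simp only [Fin.val_zero] at this
  omega

/-- Once the cycles have the same shape, agreement at the last element starts the propagation along
the second one. -/
lemma eq_of_twoCycle_comm {N : ℕ} {t t' : Fin (N + 1)} {ht : 0 < t.val} {ht' : 0 < t'.val}
    {e e' : Equiv.Perm (Fin (N + 1))} (h0 : e 0 = e' 0) (hlast : e (Fin.last N) = e' (Fin.last N))
    (hstep : ∀ i, e i = e' i → e (twoCycle t ht i) = e' (twoCycle t' ht' i)) :
    t = t' ∧ e = e' := by
  obtain rfl : t = t' := le_antisymm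
    (not_lt.1 (not_lt_of_twoCycle_comm h0.symm fun i hi => (hstep i hi.symm).symm))
    (not_lt.1 (not_lt_of_twoCycle_comm h0 hstep))
  refine ⟨rfl, ?_⟩
  have key : ∀ (i : ℕ) (hi : i < N + 1), e ⟨i, hi⟩ = e' ⟨i, hi⟩ := by
    intro i
    induction i with
    | zero => exact fun _ => h0
    | succ i ih =>
      intro hi
      by_cases hit : i + 1 = t.val
      · have := hstep _ hlast
        rw [twoCycle_last] at this
        have h1 : (⟨i + 1, hi⟩ : Fin (N + 1)) = t := Fin.ext hit
        rwa [h1]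
      · have := hstep _ (ih (by omega))
        rwa [twoCycle_of_ne hit hi] at this
  exact Equiv.ext fun i => key i i.2

/-! ### Enumeration of pointed unicycles -/

/-- The number of unicycles with a distinguished edge on their cycle, which has length `k`, and with
labelled darts. -/
lemma card_cyclePointed (N : ℕ) {k : ℕ} (hk : 0 < k) :
    Nat.card {p : Unicycle (Fin (N + 1)) × Fin (N + 1) //
      p.1.IsCycleDart p.2 ∧ p.1.cycleLength = k} =
      (N + 1).factorial * firstPassage (N + 1) (2 * k) := by
  set S : Fin (N + 1) → Type := fun t =>
    {r : Equiv.Perm (Fin (N + 1)) // (IsNoncrossing r ∧ r 0 = Fin.last N) ∧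
      Nat.card {p : Fin (N + 1) // p.val < t ∧ t ≤ (r p).val} = k} with hS
  have hS0 : ∀ {t}, S t → 0 < t.val := by
    intro t r
    by_contra h
    have h1 : IsEmpty {p : Fin (N + 1) // p.val < t.val ∧ t.val ≤ (r.1 p).val} :=
      ⟨fun p => by have := p.2.1; omega⟩
    have h2 := r.2.2
    rw [Nat.card_of_isEmpty] at h2
    omega
  have hcardS : Nat.card (Σ t, S t) = firstPassage (N + 1) (2 * k) := by
    rw [Nat.card_sigma, two_mul, ← sum_firstPassage_mul,
      Finset.Nat.sum_antidiagonal_eq_sum_range_succ_mk, Finset.sum_range_succ, Nat.sub_self]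
    -- The convolution also has a term with t = N + 1, an empty internal face, which vanishes
    -- because k > 0.
    have h0 : firstPassage 0 k = 0 := by
      obtain ⟨k, rfl⟩ := Nat.exists_eq_succ_of_ne_zero hk.ne'
      rfl
    rw [h0, mul_zero, add_zero, ← Fin.sum_univ_eq_sum_range
      (fun t => firstPassage t k * firstPassage (N + 1 - t) k)]
    exact Finset.sum_congr rfl fun t _ => card_isNoncrossing (by have := t.2; omega) hk
  have hfact : (N + 1).factorial = Nat.card (Equiv.Perm (Fin (N + 1))) := by
    rw [Nat.card_perm, Nat.card_eq_fintype_card, Fintype.card_fin]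
  rw [← hcardS, hfact, ← Nat.card_prod]
  have hlen : ∀ {t} (r : S t), (r.2.1.1.unicycle r.2.1.2 t (hS0 r)).cycleLength = k := fun r =>
    ((r.2.1.1.isStandard_unicycle r.2.1.2).cycleLength_eq).trans r.2.2
  refine (Nat.card_eq_of_bijective (fun x : Equiv.Perm (Fin (N + 1)) × Σ t, S t =>
    (⟨((x.2.2.2.1.1.unicycle x.2.2.2.1.2 x.2.1 (hS0 x.2.2)).relabel x.1, x.1 (Fin.last N)), ?_, ?_⟩ :
      {p : Unicycle (Fin (N + 1)) × Fin (N + 1) // p.1.IsCycleDart p.2 ∧ p.1.cycleLength = k}))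
    ⟨?_, ?_⟩).symm
  · exact (Unicycle.relabel_isCycleDart _ _ _).2
      (x.2.2.2.1.1.isStandard_unicycle x.2.2.2.1.2).isCycleDart
  · exact (Unicycle.cycleLength_relabel _ _).trans (hlen x.2.2)
  -- The distinguished dart fixes the renaming at the last element, `rev` fixes it at 0, and
  -- following the faces fixes t and the whole renaming; conjugating back recovers the matching.
  · rintro ⟨e, t, r⟩ ⟨e', t', r'⟩ h
    have h := congrArg Subtype.val h
    simp only [Prod.mk.injEq] at h
    obtain ⟨h, hlast⟩ := h
    have hrev : e * r.1 * e⁻¹ = e' * r'.1 * e'⁻¹ :=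
      congrArg (fun v : Unicycle (Fin (N + 1)) => v.rev) h
    have hface : e * twoCycle t (hS0 r) * e⁻¹ = e' * twoCycle t' (hS0 r') * e'⁻¹ := by
      have := congrArg (fun v : Unicycle (Fin (N + 1)) => v.faceNext) h
      rw [← r.2.1.1.faceNext_combMap r.2.1.2, ← r'.2.1.1.faceNext_combMap r'.2.1.2]
      exact ((CombMap.faceNext_relabel _ e).symm.trans this).trans (CombMap.faceNext_relabel _ e')
    have hconj : ∀ {f f' : Equiv.Perm (Fin (N + 1))}, e * f * e⁻¹ = e' * f' * e'⁻¹ →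
        ∀ i, e i = e' i → e (f i) = e' (f' i) := by
      intro f f' hf i hi
      have h1 : e (f (e⁻¹ (e i))) = e' (f' (e'⁻¹ (e i))) := Equiv.congr_fun hf (e i)
      have h2 : e⁻¹ (e i) = i := e.symm_apply_apply i
      have h3 : e'⁻¹ (e i) = i := by rw [hi]; exact e'.symm_apply_apply i
      rwa [h2, h3] at h1
    have hz : ∀ {t} (r : S t), r.1 (Fin.last N) = 0 := fun r =>
      (congrArg r.1 r.2.1.2.symm).trans (r.2.1.1.1 0)
    have h0 : e 0 = e' 0 := by
      have := hconj hrev _ hlast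
      rwa [hz r, hz r'] at this
    obtain ⟨rfl, rfl⟩ := eq_of_twoCycle_comm h0 hlast (hconj hface)
    have hr : r = r' := Subtype.ext (by simpa using hrev)
    rw [hr]
  · rintro ⟨⟨u, d₀⟩, hd, hu⟩
    obtain ⟨e, t, ht, hstd, hlast⟩ := u.exists_isStandard_relabel hd
    have hr : (IsNoncrossing (u.relabel e⁻¹).rev ∧ (u.relabel e⁻¹).rev 0 = Fin.last N) ∧
        Nat.card {p : Fin (N + 1) // p.val < t ∧ t ≤ ((u.relabel e⁻¹).rev p).val} = k :=
      ⟨⟨hstd.isNoncrossing, hstd.rev_zero⟩, by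
        rw [← hu, ← u.cycleLength_relabel e⁻¹, hstd.cycleLength_eq]⟩
    refine ⟨⟨e, t, ⟨(u.relabel e⁻¹).rev, hr⟩⟩, Subtype.ext (Prod.ext ?_ hlast)⟩
    -- Standard unicycles with the same t and the same `rev` coincide: `rot` is `faceNext` after
    -- `rev`, and t tells the faces apart.
    have hcan := hr.1.1.isStandard_unicycle hr.1.2 (t := t) (ht := ht)
    have : hr.1.1.unicycle hr.1.2 t ht = u.relabel e⁻¹ := by
      refine Unicycle.ext_of_darts rfl (Equiv.ext fun d => ?_) (fun d => ?_) fun d => ?_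
      · rw [CombMap.rot_eq, CombMap.rot_eq, hcan.faceNext_eq, hstd.faceNext_eq]
        rfl
      · rw [hcan.leftFace_eq_internal_iff, hstd.leftFace_eq_internal_iff]
      · rw [hcan.leftFace_eq_external_iff, hstd.leftFace_eq_external_iff]
    simp only
    rw [this, u.relabel_inv_relabel]

namespace Unicycle

lemma cycleLength_mem {N : ℕ} {n : ℕ} (h : N + 1 = 2 * n) (u : Unicycle (Fin (N + 1))) :
    u.cycleLength ∈ Finset.Icc 1 n := by
  classical
  rw [Finset.mem_Icc]
  constructor
  · obtain ⟨d, hd, hd'⟩ := u.exists_separating_dart u.internal_ne_external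
    have : Nonempty {d // u.IsCycleDart d} := ⟨⟨d, hd, u.not_eq_internal_iff.1 hd'⟩⟩
    exact Nat.card_pos
  · obtain ⟨o, ho1, ho2⟩ := u.exists_orientation
    have h1 := Finite.card_subtype_le fun e => u.IsCycleDart (o e)
    rw [u.card_cycle_edges ho1 ho2] at h1
    have h2 := u.two_mul_card_edge
    rw [Nat.card_eq_fintype_card (α := Fin (N + 1)), Fintype.card_fin] at h2
    omega

/-- Sums of functions of the cycle length over the unicycles with labelled darts. -/
lemma sum_cycleLength_mul {n : ℕ} (hn : 0 < n) [Fintype (Unicycle (Fin (2 * n)))] (F : ℕ → ℚ) :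
    ∑ u : Unicycle (Fin (2 * n)), u.cycleLength * F u.cycleLength =
      (2 * n).factorial * ∑ k ∈ Finset.Icc 1 n, firstPassage (2 * n) (2 * k) * F k := by
  classical
  obtain ⟨N, hN⟩ : ∃ N, N + 1 = 2 * n := ⟨2 * n - 1, by omega⟩
  have hmem := cycleLength_mem hN
  have hcard := @card_cyclePointed N
  revert hmem hcard
  rw [hN]
  intro hmem hcard
  rw [← Finset.sum_fiberwise_of_maps_to (fun u _ => hmem u), Finset.mul_sum]
  refine Finset.sum_congr rfl fun k hk => ?_
  have hk := (Finset.mem_Icc.1 hk).1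
  rw [← mul_assoc, ← Nat.cast_mul, ← hcard hk]
  -- Summing cycle lengths at fixed k counts the pairs of a unicycle and a cycle dart.
  have h1 : ∑ u : Unicycle (Fin (2 * n)) with u.cycleLength = k, u.cycleLength * F u.cycleLength =
      (∑ u : Unicycle (Fin (2 * n)) with u.cycleLength = k, u.cycleLength : ℕ) * F k := by
    rw [Nat.cast_sum, Finset.sum_mul]
    exact Finset.sum_congr rfl fun u hu => by rw [(Finset.mem_filter.1 hu).2]
  rw [h1]
  congr 2
  have h2 : {p : Unicycle (Fin (2 * n)) × Fin (2 * n) //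
      p.1.IsCycleDart p.2 ∧ p.1.cycleLength = k} ≃
      (u : {u : Unicycle (Fin (2 * n)) // u.cycleLength = k}) × {d // u.1.IsCycleDart d} :=
    { toFun := fun p => ⟨⟨p.1.1, p.2.2⟩, p.1.2, p.2.1⟩
      invFun := fun q => ⟨(q.1.1, q.2.1), q.2.2, q.1.2⟩
      left_inv := fun _ => rfl
      right_inv := fun _ => rfl }
  rw [Nat.card_congr h2, Nat.card_sigma]
  exact Finset.sum_subtype _ (by simp) _

end Unicycle

/-! ### Exact formulas and conclusion -/

lemma card_cyclePointedUnicycles {n : ℕ} (hn : 0 < n) :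
    n * Nat.card (CyclePointedUnicycles n) = ∑ k ∈ Finset.Icc 1 n,
      k * (centralTrinomial k * 3 ^ (n - k) * (2 * n).choose (n + k)) := by
  have := Fintype.ofFinite (Unicycle (Fin (2 * n)))
  have h1 := card_rootOnCycle_eq n
  rw [Unicycle.card_rootOnCycle, Nat.card_eq_fintype_card (α := Fin (2 * n)), Fintype.card_fin,
    Nat.mul_div_cancel_left _ two_pos] at h1
  have h2 := Unicycle.sum_cycleLength_mul hn fun k => 3 ^ (n - k) * centralTrinomial k
  have h3 : ((2 * n).factorial * Nat.card (CyclePointedUnicycles n) : ℚ) = (2 * n).factorial *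
      ∑ k ∈ Finset.Icc 1 n, firstPassage (2 * n) (2 * k) * (3 ^ (n - k) * centralTrinomial k) := by
    push_cast
    rw [← h2]
    exact_mod_cast h1.symm
  have h4 : Nat.card (CyclePointedUnicycles n) =
      ∑ k ∈ Finset.Icc 1 n, firstPassage (2 * n) (2 * k) * (3 ^ (n - k) * centralTrinomial k) := by
    exact_mod_cast mul_left_cancel₀ (by positivity) h3
  rw [h4, Finset.mul_sum]
  refine Finset.sum_congr rfl fun k hk => ?_
  rw [← mul_assoc, mul_firstPassage_two_mul (Finset.mem_Icc.1 hk).2]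
  ring

/-- The pointed enumeration weights a unicycle by its cycle length k, whereas it has 2n possible
roots; the summand is therefore multiplied by 2n/k. -/
lemma card_wellLabelledUnicycles {n : ℕ} (hn : 0 < n) :
    Nat.card (WellLabelledUnicycles n) = 2 * ∑ k ∈ Finset.Icc 1 n,
      centralTrinomial k * 3 ^ (n - k) * (2 * n).choose (n + k) := by
  have := Fintype.ofFinite (Unicycle (Fin (2 * n)))
  have h1 := card_rootedUnicycle_eq n
  rw [Unicycle.card_rootedUnicycle, Nat.card_eq_fintype_card (α := Fin (2 * n)), Fintype.card_fin,
    Nat.mul_div_cancel_left _ two_pos] at h1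
  have h2 := Unicycle.sum_cycleLength_mul hn
    fun k => (2 * n / k : ℚ) * (3 ^ (n - k) * centralTrinomial k)
  have hpos : ∀ u : Unicycle (Fin (2 * n)), (u.cycleLength : ℚ) ≠ 0 := by
    obtain ⟨N, hN⟩ : ∃ N, N + 1 = 2 * n := ⟨2 * n - 1, by omega⟩
    have hmem := Unicycle.cycleLength_mem hN
    revert hmem
    rw [hN]
    intro hmem u
    have := (Finset.mem_Icc.1 (hmem u)).1
    positivity
  have h3 : ((2 * n).factorial * Nat.card (WellLabelledUnicycles n) : ℚ) = (2 * n).factorial *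
      (2 * ∑ k ∈ Finset.Icc 1 n, centralTrinomial k * 3 ^ (n - k) * (2 * n).choose (n + k) : ℕ) := by
    have h4 : ((2 * n).factorial * Nat.card (WellLabelledUnicycles n) : ℚ) =
        ∑ u : Unicycle (Fin (2 * n)), (u.cycleLength : ℚ) * ((2 * n / u.cycleLength : ℚ) *
          (3 ^ (n - u.cycleLength) * centralTrinomial u.cycleLength)) := by
      rw [← Nat.cast_mul, ← h1, Nat.cast_sum]
      refine Finset.sum_congr rfl fun u _ => ?_
      have := hpos u
      push_cast
      field_simp
    rw [h4, h2]
    congr 1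
    push_cast
    rw [Finset.mul_sum]
    refine Finset.sum_congr rfl fun k hk => ?_
    have hk0 : (k : ℚ) ≠ 0 := by
      have := (Finset.mem_Icc.1 hk).1
      positivity
    have h5 : (n * firstPassage (2 * n) (2 * k) : ℚ) = k * (2 * n).choose (n + k) := by
      exact_mod_cast mul_firstPassage_two_mul (Finset.mem_Icc.1 hk).2
    field_simp
    linear_combination (centralTrinomial k : ℚ) * h5
  exact_mod_cast mul_left_cancel₀ (by positivity) h3

theorem theorem2p8 :
    Asymptotics.IsEquivalent Filter.atTop
      (fun n : ℕ => (Nat.card (WellLabelledUnicycles n) : ℝ))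
      (fun n : ℕ => √3 * Real.Gamma (1 / 4) * 12 ^ n / (2 * Real.pi * (n : ℝ) ^ (1 / 4 : ℝ))) ∧
    Asymptotics.IsEquivalent Filter.atTop
      (fun n : ℕ => (Nat.card (CyclePointedUnicycles n) : ℝ))
      (fun n : ℕ => √3 * Real.Gamma (3 / 4) * 12 ^ n / (4 * Real.pi * (n : ℝ) ^ (3 / 4 : ℝ))) := by
  constructor
  · refine isEquivalent_sum_centralTrinomial_mul_choose.congr_left ?_
    filter_upwards [eventually_gt_atTop 0] with n hn
    rw [card_wellLabelledUnicycles hn]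
    push_cast
    rfl
  · refine isEquivalent_sum_mul_centralTrinomial_mul_choose.congr_left ?_
    filter_upwards [eventually_gt_atTop 0] with n hn
    have hn' : (n : ℝ) ≠ 0 := by positivity
    have h : (n * Nat.card (CyclePointedUnicycles n) : ℝ) = ∑ k ∈ Finset.Icc 1 n,
        (k * (centralTrinomial k * 3 ^ (n - k) * (2 * n).choose (n + k)) : ℝ) := by
      exact_mod_cast card_cyclePointedUnicycles hn
    rw [← h]
    field_simp
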